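/- Let $q,s\ge 0$ be integers, let $\tau>0$, and let $V_1,\dots,V_s\in\mathbb Z^q$ be linearly independent vectors spanning the subspace $L$ of $\mathbb R^q$. For $w\in\mathbb Z^s$ let $B_w:=\{\sum_a t_aV_a : t\in\mathbb R^s,\ \lfloor t_a\rfloor=w_a \text{ for all } a\}$. For $\lambda=(\lambda_1,\dots,\lambda_q)\in[0,\infty)^q$ put $\nu:=\sum_i\lambda_i$ and $D:=\mathrm{diag}(\sqrt{\lambda_1},\dots,\sqrt{\lambda_q})$; let $Y=(Y_1,\dots,Y_q)$ have independent coordinates $Y_i\sim\mathrm{Poisson}(\lambda_i)$, let $X:=D^{-1}(Y-\lambda)$, and let $\mathbb Q$ denote expectation under $\mathbb P(\,\cdot\mid Y\in\lambda+L)$. Let $\mathcal N_\lambda$ be the normal distribution on the subspace $D^{-1}L$ with density $(2\pi)^{-s/2}e^{-|x|^2/2}$ with respect to Lebesgue measure on $D^{-1}L$. Let $g:[0,\infty)\to\mathbb R$ be uniformly continuous and increasing (in the weak sense). Then for every $\theta>1$ there exist $\delta>0$, $\eta>0$ and $\nu_0$ (depending only on $\theta$, $g$, $\tau$ and $V_1,\dots,V_s$)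 such that for every $\lambda$ with $$\nu\ge\nu_0,\qquad \min_i\lambda_i\ge\tau\nu,\qquad \mathbb Z^q\cap(\lambda+L)\ne\emptyset,$$ the event $\{Y\in\lambda+L\}$ has positive probability and the set $$L_\delta:=\bigcup\{B_w : w\in\mathbb Z^s,\ \max_a|w_a|\le\eta\nu\}\subseteq L$$ satisfies (i) $\{x\in D^{-1}L : |x|\le\delta\sqrt\nu\}\subseteq D^{-1}L_\delta$; (ii) $\mathbb Q\big[\exp(g(|X|^2))\,\mathbf 1\{X\in D^{-1}L_\delta\}\big]\le\theta\,\mathcal N_\lambda\big[\exp(g(\theta^2|x|^2))\,\mathbf 1\{x\in\theta^{-1}D^{-1}L_\delta\}\big]$. -/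

import Mathlib

open MeasureTheory ProbabilityTheory
open scoped NNReal ENNReal

noncomputable section

/-- The total `ν = ∑ i, λ i` of the Poisson means. -/
def totalMean {q : ℕ} (lam : Fin q → ℝ≥0) : ℝ := ∑ i, (lam i : ℝ)

/-- The vector of means `λ` as a point of Euclidean space `ℝ^q`. -/
def meanVec {q : ℕ} (lam : Fin q → ℝ≥0) : EuclideanSpace ℝ (Fin q) :=
  WithLp.toLp 2 fun i => (lam i : ℝ)

/-- An integer vector as a point of Euclidean space `ℝ^q`. -/
def intVec {q : ℕ} (v : Fin q → ℤ) : EuclideanSpace ℝ (Fin q) :=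
  WithLp.toLp 2 fun i => (v i : ℝ)

/-- A vector of counts as a point of Euclidean space `ℝ^q`. -/
def countVec {q : ℕ} (y : Fin q → ℕ) : EuclideanSpace ℝ (Fin q) :=
  WithLp.toLp 2 fun i => (y i : ℝ)

/-- The linear map `D⁻¹`, where `D = diag (√λ 1, …, √λ q)`. -/
def invD {q : ℕ} (lam : Fin q → ℝ≥0) :
    EuclideanSpace ℝ (Fin q) →ₗ[ℝ] EuclideanSpace ℝ (Fin q) where
  toFun x := WithLp.toLp 2 fun i => x i / Real.sqrt (lam i)
  map_add' x y := by ext i; simp [add_div]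
  map_smul' c x := by ext i; simp [mul_div_assoc]

/-- The standardized vector `X = D⁻¹ (Y - λ)`. -/
def stdVec {q : ℕ} (lam : Fin q → ℝ≥0) (y : Fin q → ℕ) : EuclideanSpace ℝ (Fin q) :=
  invD lam (countVec y - meanVec lam)

/-- The subspace `L` of `ℝ^q` spanned by the integer vectors `V 1, …, V s`. -/
def latticeSpan {q s : ℕ} (V : Fin s → Fin q → ℤ) : Submodule ℝ (EuclideanSpace ℝ (Fin q)) :=
  Submodule.span ℝ (Set.range fun a => intVec (V a))

/-- The box `B_w = {∑ t_a V_a : ⌊t_a⌋ = w_a for all a}`. -/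
def latticeBox {q s : ℕ} (V : Fin s → Fin q → ℤ) (w : Fin s → ℤ) :
    Set (EuclideanSpace ℝ (Fin q)) :=
  {x | ∃ t : Fin s → ℝ, (∀ a, ⌊t a⌋ = w a) ∧ x = ∑ a, t a • intVec (V a)}

/-- The union of the boxes `B_w` over all `w ∈ ℤ^s` with `max_a |w_a| ≤ r`. -/
def boxRegion {q s : ℕ} (V : Fin s → Fin q → ℤ) (r : ℝ) : Set (EuclideanSpace ℝ (Fin q)) :=
  ⋃ w ∈ {w : Fin s → ℤ | ∀ a, |(w a : ℝ)| ≤ r}, latticeBox V w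

/-- The joint law of independent `Y i ∼ Poisson (λ i)`. -/
def poissonLaw {q : ℕ} (lam : Fin q → ℝ≥0) : Measure (Fin q → ℕ) :=
  Measure.pi fun i => poissonMeasure (lam i)

/-- The event `{Y ∈ λ ⊕ L}`. -/
def linearEvent {q : ℕ} (lam : Fin q → ℝ≥0) (L : Submodule ℝ (EuclideanSpace ℝ (Fin q))) :
    Set (Fin q → ℕ) :=
  {y | countVec y - meanVec lam ∈ L}

/-- The conditional law of `Y` given `Y ∈ λ ⊕ L`. -/
def condLaw {q : ℕ} (lam : Fin q → ℝ≥0) (L : Submodule ℝ (EuclideanSpace ℝ (Fin q))) :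
    Measure (Fin q → ℕ) :=
  ProbabilityTheory.cond (poissonLaw lam) (linearEvent lam L)

/-- The standard normal distribution on a subspace `E` of `ℝ^q`, as a measure on `ℝ^q` carried
by `E`: it has density `(2π)^(-dim E / 2) exp (-|x|² / 2)` with respect to Lebesgue measure on `E`
(the Haar measure giving mass one to the unit cube of an orthonormal basis of `E`). -/
def subspaceGaussian {q : ℕ} (E : Submodule ℝ (EuclideanSpace ℝ (Fin q))) :
    Measure (EuclideanSpace ℝ (Fin q)) :=
  ((stdOrthonormalBasis ℝ E).toBasis.addHaar.withDensity fun x : E =>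
    ENNReal.ofReal ((2 * Real.pi) ^ (-(Module.finrank ℝ E : ℝ) / 2)
      * Real.exp (-‖x‖ ^ 2 / 2))).map Subtype.val

/-- The normal distribution `N_λ` on the subspace `D⁻¹ L`. -/
def limitNormal {q : ℕ} (lam : Fin q → ℝ≥0) (L : Submodule ℝ (EuclideanSpace ℝ (Fin q))) :
    Measure (EuclideanSpace ℝ (Fin q)) :=
  subspaceGaussian (L.map (invD lam))

end

/-!
By Stirling's formula, a Poisson weight near its mean is a Gaussian weight up to a factor
`exp (± ε)` and a relative change `ε` of the variance. The boxes `B_w` become small after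
multiplication by `D⁻¹`, so the probability of every count vector in a box is comparable to the
Gaussian weight at every point of that box; uniform continuity makes `g (|x|²)` vary within the box
by at most `ε (1 + |x|²)`, which is absorbed into the factor and the variance.

Translations by the `V a` permute the integer vectors and the boxes, so all boxes hold the same
number of count vectors. This number is unknown, but it appears both in the numerator and in the
denominator of the conditional expectation and cancels, which leaves a ratio of Gaussian integrals.

The slack `θ > 1` pays for the change of variance. On a fixed ball the change costs a factor close
to `1`, and `g (|x|²) ≤ g (θ² |x|²)` by monotonicity; outside the ball the weight with variance
close to `1` is negligible against the weight with variance `θ²`, which is the one obtained from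
`N_λ` by the substitution `x ↦ θ x`.
-/

section PoissonWeights

open Filter Topology Asymptotics InformationTheory

theorem klFun_sub_half_sq_isLittleO :
    (fun x : ℝ => klFun x - (x - 1) ^ 2 / 2) =o[𝓝 1] fun x => (x - 1) ^ 2 := by
  have hlog : (fun x : ℝ => Real.log x - (x - 1)) =o[𝓝 1] fun x => x - 1 := by
    simpa using (Real.hasDerivAt_log one_ne_zero).isLittleO
  refine isLittleO_iff.2 fun c hc => ?_
  obtain ⟨δ, hδ, hball⟩ := Metric.eventually_nhds_iff_ball.1
    ((hlog.bound hc).and (eventually_ne_nhds one_ne_zero))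
  filter_upwards [Metric.ball_mem_nhds 1 hδ] with x hx
  have hsub : Metric.closedBall (1 : ℝ) |x - 1| ⊆ Metric.ball 1 δ :=
    Metric.closedBall_subset_ball (by simpa [Real.dist_eq] using hx)
  have hderiv : ∀ y ∈ Metric.closedBall (1 : ℝ) |x - 1|, HasDerivWithinAt
      (fun x => klFun x - (x - 1) ^ 2 / 2) (Real.log y - (y - 1)) (Metric.closedBall 1 |x - 1|) y :=
    fun y hy => by
      have hsq := (((hasDerivAt_id' y).sub_const 1).pow 2).div_const 2
      exact ((hasDerivAt_klFun (hball y (hsub hy)).2).fun_sub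
        (hsq.congr_deriv (by ring))).hasDerivWithinAt
  have hbound : ∀ y ∈ Metric.closedBall (1 : ℝ) |x - 1|,
      ‖Real.log y - (y - 1)‖ ≤ c * |x - 1| := fun y hy =>
    (hball y (hsub hy)).1.trans (by gcongr; simpa [Real.dist_eq] using hy)
  have := (convex_closedBall 1 |x - 1|).norm_image_sub_le_of_norm_hasDerivWithin_le hderiv hbound
    (Metric.mem_closedBall_self (abs_nonneg _)) (by simp [Real.dist_eq] : x ∈ _)
  calc ‖klFun x - (x - 1) ^ 2 / 2‖ ≤ c * |x - 1| * ‖x - 1‖ := by simpa [klFun_one] using this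
    _ = c * ‖(x - 1) ^ 2‖ := by rw [norm_pow, Real.norm_eq_abs]; ring

theorem log_poisson_weight_eq {r : ℝ} (hr : 0 < r) {n : ℕ} (hn : n ≠ 0) :
    Real.log (Real.exp (-r) * r ^ n / n.factorial)
      = -(r * klFun (n / r)) - Real.log (2 * n) / 2 - Real.log (Stirling.stirlingSeq n) := by
  have hn' : (0 : ℝ) < n := by positivity
  rw [Stirling.log_stirlingSeq_formula, Real.log_div (by positivity) (by positivity),
    Real.log_mul (by positivity) (by positivity), Real.log_exp, Real.log_pow, klFun_apply,
    Real.log_div hn'.ne' hr.ne', Real.log_div hn'.ne' (Real.exp_ne_zero 1), Real.log_exp]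
  field_simp
  ring

theorem log_sqrt_two_pi_mul_add_log_poisson_weight {r : ℝ} (hr : 0 < r) {n : ℕ} (hn : n ≠ 0) :
    Real.log (√(2 * Real.pi * r)) + Real.log (Real.exp (-r) * r ^ n / n.factorial)
      = -(r * klFun (n / r)) - Real.log (n / r) / 2
        - (Real.log (Stirling.stirlingSeq n) - Real.log √Real.pi) := by
  rw [log_poisson_weight_eq hr hn, Real.log_sqrt (by positivity), Real.log_sqrt Real.pi_pos.le,
    Real.log_div (by positivity) hr.ne', Real.log_mul (by positivity) hr.ne',
    Real.log_mul two_ne_zero Real.pi_ne_zero, Real.log_mul two_ne_zero (by positivity)]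
  ring

theorem exists_abs_log_poisson_weight_le {ε : ℝ} (hε : 0 < ε) :
    ∃ δ > 0, ∃ M > 0, ∀ (r : ℝ) (n : ℕ), M ≤ r → |(n : ℝ) - r| ≤ δ * r →
      |Real.log √(2 * Real.pi * r) + Real.log (Real.exp (-r) * r ^ n / n.factorial)
        + (n - r) ^ 2 / (2 * r)| ≤ ε + ε * ((n - r) ^ 2 / (2 * r)) := by
  have hlog : ∀ᶠ x : ℝ in 𝓝 1, |Real.log x| < ε := by
    simpa [Real.dist_eq] using Metric.tendsto_nhds.1 (Real.continuousAt_log one_ne_zero) ε hε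
  obtain ⟨d, hd, hball⟩ := Metric.eventually_nhds_iff_ball.1
    ((klFun_sub_half_sq_isLittleO.bound (half_pos hε)).and hlog)
  have hstirling : ∀ᶠ n in atTop,
      |Real.log (Stirling.stirlingSeq n) - Real.log √Real.pi| < ε / 2 :=
    Metric.tendsto_nhds.1 (((Real.continuousAt_log (by positivity)).tendsto.comp
      Stirling.tendsto_stirlingSeq_sqrt_pi)) _ (half_pos hε)
  obtain ⟨N, hN⟩ := eventually_atTop.1 hstirling
  refine ⟨min (d / 2) (1 / 2), by positivity, 2 * (N + 1), by positivity, fun r n hr hn => ?_⟩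
  have hr0 : 0 < r := lt_of_lt_of_le (by positivity) hr
  have hn1 : |(n : ℝ) / r - 1| ≤ min (d / 2) (1 / 2) := by
    rwa [div_sub_one hr0.ne', abs_div, abs_of_pos hr0, div_le_iff₀ hr0]
  have hNn : (N : ℝ) + 1 ≤ n := by
    have := (abs_le.1 (hn1.trans (min_le_right _ _))).1
    have : 1 / 2 ≤ (n : ℝ) / r := by linarith
    rw [le_div_iff₀ hr0] at this
    linarith
  have hn0 : n ≠ 0 := by rintro rfl; push_cast at hNn; linarith [N.cast_nonneg (α := ℝ)]
  obtain ⟨hkl, hlog⟩ := hball (n / r) (by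
    rw [Metric.mem_ball, Real.dist_eq]; linarith [hn1.trans (min_le_left _ _)])
  have hsq : r * ((n / r - 1) ^ 2 / 2) = ((n : ℝ) - r) ^ 2 / (2 * r) := by field_simp
  have hkl' : |r * klFun (n / r) - (n - r) ^ 2 / (2 * r)| ≤ ε * ((n - r) ^ 2 / (2 * r)) := by
    rw [← hsq, ← mul_sub, abs_mul, abs_of_pos hr0]
    calc r * |klFun (n / r) - (n / r - 1) ^ 2 / 2|
        ≤ r * (ε / 2 * ‖((n : ℝ) / r - 1) ^ 2‖) := by gcongr; exact hkl
      _ = ε * (r * ((n / r - 1) ^ 2 / 2)) := by rw [Real.norm_of_nonneg (sq_nonneg _)]; ring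
  have hstir := hN n (by exact_mod_cast (by linarith : (N : ℝ) ≤ n))
  rw [log_sqrt_two_pi_mul_add_log_poisson_weight hr0 hn0]
  rw [abs_le] at hkl' ⊢
  rw [abs_lt] at hlog hstir
  constructor <;> linarith

end PoissonWeights

section PoissonVectors

variable {q : ℕ}

/-- The factor `∏ i, (2π λ i)^(-1/2)`, which normalizes the Gaussian approximation of the law of
independent Poisson variables with means `λ i`. -/
noncomputable def gaussNorm (lam : Fin q → ℝ≥0) : ℝ := ∏ i, (√(2 * Real.pi * lam i))⁻¹

theorem gaussNorm_pos {lam : Fin q → ℝ≥0} (h : ∀ i, 0 < lam i) : 0 < gaussNorm lam :=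
  Finset.prod_pos fun i _ => by have := h i; positivity

theorem norm_invD_sq (lam : Fin q → ℝ≥0) (x : EuclideanSpace ℝ (Fin q)) :
    ‖invD lam x‖ ^ 2 = ∑ i, x i ^ 2 / lam i := by
  rw [EuclideanSpace.norm_sq_eq]
  simp [invD, div_pow]

theorem norm_stdVec_sq (lam : Fin q → ℝ≥0) (y : Fin q → ℕ) :
    ‖stdVec lam y‖ ^ 2 = ∑ i, ((y i : ℝ) - lam i) ^ 2 / lam i :=
  norm_invD_sq lam _

instance isProbabilityMeasure_poissonLaw (lam : Fin q → ℝ≥0) :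
    IsProbabilityMeasure (poissonLaw lam) :=
  inferInstanceAs (IsProbabilityMeasure (Measure.pi fun i => poissonMeasure (lam i)))

theorem poissonLaw_singleton (lam : Fin q → ℝ≥0) (y : Fin q → ℕ) :
    poissonLaw lam {y} = ENNReal.ofReal
      (∏ i, (Real.exp (-lam i) * (lam i : ℝ) ^ (y i) / (y i).factorial)) := by
  rw [poissonLaw, Measure.pi_singleton, ENNReal.ofReal_prod_of_nonneg (fun i _ => by positivity)]
  simp_rw [poissonMeasure_singleton]

theorem exists_abs_log_poisson_weights_le (q : ℕ) {ε : ℝ} (hε : 0 < ε) :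
    ∃ δ > 0, ∃ M > (0 : ℝ), ∀ (lam : Fin q → ℝ≥0) (y : Fin q → ℕ),
      (∀ i, M ≤ lam i) → (∀ i, |(y i : ℝ) - lam i| ≤ δ * lam i) →
      |Real.log (∏ i, (Real.exp (-lam i) * (lam i : ℝ) ^ (y i) / (y i).factorial))
        - Real.log (gaussNorm lam) + ‖stdVec lam y‖ ^ 2 / 2|
        ≤ ε + ε * (‖stdVec lam y‖ ^ 2 / 2) := by
  obtain ⟨δ, hδ, M, hM, H⟩ := exists_abs_log_poisson_weight_le (ε := ε / (q + 1)) (by positivity)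
  refine ⟨δ, hδ, M, hM, fun lam y hlam hy => ?_⟩
  have hpos : ∀ i, (0 : ℝ) < lam i := fun i => hM.trans_le (hlam i)
  have hnorm : ‖stdVec lam y‖ ^ 2 / 2 = ∑ i, ((y i : ℝ) - lam i) ^ 2 / (2 * lam i) := by
    rw [norm_stdVec_sq, Finset.sum_div]
    exact Finset.sum_congr rfl fun i _ => by rw [div_div, mul_comm]
  have hε_le : ε / (q + 1) ≤ ε := div_le_self hε.le (by simp)
  have hq_le : (q : ℝ) * (ε / (q + 1)) ≤ ε := by
    rw [mul_div_left_comm]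
    exact mul_le_of_le_one_right hε.le ((div_le_one (by positivity)).2 (by simp))
  have hweight : ∀ i,
      Real.exp (-lam i) * (lam i : ℝ) ^ (y i) / (y i).factorial ≠ 0 := fun i => by
    have := hpos i; positivity
  have hsqrt : ∀ i, (√(2 * Real.pi * lam i))⁻¹ ≠ 0 := fun i => by
    have := hpos i; positivity
  rw [gaussNorm, Real.log_prod fun i _ => hweight i, Real.log_prod fun i _ => hsqrt i, hnorm,
    ← Finset.sum_sub_distrib, ← Finset.sum_add_distrib]
  calc _ ≤ ∑ i, (ε / (q + 1) + ε / (q + 1) * (((y i : ℝ) - lam i) ^ 2 / (2 * lam i))) := by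
        refine (Finset.abs_sum_le_sum_abs _ _).trans (Finset.sum_le_sum fun i _ => ?_)
        rw [Real.log_inv, sub_neg_eq_add, add_comm (Real.log _)]
        exact H (lam i) (y i) (hlam i) (hy i)
    _ = q * (ε / (q + 1))
          + ε / (q + 1) * ∑ i, ((y i : ℝ) - lam i) ^ 2 / (2 * lam i) := by
        rw [Finset.sum_add_distrib, ← Finset.mul_sum]; simp
    _ ≤ _ := by gcongr

theorem exists_poissonLaw_singleton_bounds (q : ℕ) {ε : ℝ} (hε : 0 < ε) :
    ∃ δ > 0, ∃ M : ℝ, ∀ (lam : Fin q → ℝ≥0) (y : Fin q → ℕ),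
      (∀ i, M ≤ lam i) → (∀ i, |(y i : ℝ) - lam i| ≤ δ * lam i) →
      poissonLaw lam {y} ∈ Set.Icc
        (ENNReal.ofReal (gaussNorm lam * Real.exp (-ε - (1 + ε) * ‖stdVec lam y‖ ^ 2 / 2)))
        (ENNReal.ofReal (gaussNorm lam * Real.exp (ε - (1 - ε) * ‖stdVec lam y‖ ^ 2 / 2))) := by
  obtain ⟨δ, hδ, M, hM, H⟩ := exists_abs_log_poisson_weights_le q hε
  refine ⟨δ, hδ, M, fun lam y hlam hy => ?_⟩
  have hpos : ∀ i, 0 < lam i := fun i => NNReal.coe_pos.1 (hM.trans_le (hlam i))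
  have hgauss : 0 < gaussNorm lam := gaussNorm_pos hpos
  have hweight : 0 < ∏ i, (Real.exp (-lam i) * (lam i : ℝ) ^ (y i) / (y i).factorial) :=
    Finset.prod_pos fun i _ => by have := hpos i; positivity
  obtain ⟨hlower, hupper⟩ := abs_le.1 (H lam y hlam hy)
  rw [poissonLaw_singleton]
  have hexp_log : ∀ e, gaussNorm lam * Real.exp e = Real.exp (Real.log (gaussNorm lam) + e) :=
    fun e => by rw [Real.exp_add, Real.exp_log hgauss]
  constructor <;> refine ENNReal.ofReal_le_ofReal ?_ <;> rw [hexp_log]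
  · exact (Real.le_log_iff_exp_le hweight).1 (by linarith)
  · exact (Real.log_le_iff_le_exp hweight).1 (by linarith)

end PoissonVectors

section Cubes

variable {ι : Type*}

/-- The integral corner of the half-open unit cube containing `t`. -/
noncomputable def floorVec (t : ι → ℝ) : ι → ℤ := fun a => ⌊t a⌋

/-- The union of the half-open unit cubes whose corners have coordinates bounded by `r`. -/
def cubeRegion (r : ℝ) : Set (ι → ℝ) := {t | ∀ a, |(floorVec t a : ℝ)| ≤ r}

theorem floorVec_add_intCast (t : ι → ℝ) (w : ι → ℤ) :
    floorVec (t + fun a => (w a : ℝ)) = floorVec t + w := by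
  ext a
  simp [floorVec]

theorem measurable_floorVec : Measurable (floorVec : (ι → ℝ) → ι → ℤ) :=
  measurable_pi_lambda _ fun a => Int.measurable_floor.comp (measurable_pi_apply a)

theorem measurableSet_cubeRegion [Finite ι] (r : ℝ) :
    MeasurableSet (cubeRegion r : Set (ι → ℝ)) :=
  measurable_floorVec (Set.to_countable {w : ι → ℤ | ∀ a, |(w a : ℝ)| ≤ r}).measurableSet

variable [Fintype ι]

theorem map_floorVec_volume : (volume : Measure (ι → ℝ)).map floorVec = Measure.count := by
  refine Measure.ext_of_singleton fun w => ?_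
  have hcube : floorVec ⁻¹' {w} = Set.univ.pi fun a => Set.Ico (w a : ℝ) (w a + 1) := by
    ext t
    simp [funext_iff, floorVec, Int.floor_eq_iff]
  rw [Measure.map_apply measurable_floorVec (measurableSet_singleton w), hcube, volume_pi_pi]
  simp

theorem setLIntegral_cubeRegion_comp_floorVec (r : ℝ) (F : (ι → ℤ) → ℝ≥0∞) :
    ∫⁻ t in cubeRegion r, F (floorVec t)
      = ∑' w : {w : ι → ℤ | ∀ a, |(w a : ℝ)| ≤ r}, F w := by
  have hmap := setLIntegral_map (μ := (volume : Measure (ι → ℝ)))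
    (Set.to_countable {w : ι → ℤ | ∀ a, |(w a : ℝ)| ≤ r}).measurableSet
    (measurable_of_countable F) measurable_floorVec
  rw [map_floorVec_volume, lintegral_countable _ (Set.to_countable _)] at hmap
  simp only [Measure.count_singleton, mul_one] at hmap
  exact hmap.symm

theorem norm_le_of_mem_cubeRegion {r : ℝ} (hr : 0 ≤ r) {t : ι → ℝ} (ht : t ∈ cubeRegion r) :
    ‖t‖ ≤ r + 1 := by
  refine (pi_norm_le_iff_of_nonneg (by linarith)).2 fun a => abs_le.2 ?_
  obtain ⟨hlower, hupper⟩ : -r ≤ ⌊t a⌋ ∧ ⌊t a⌋ ≤ r := abs_le.1 (ht a)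
  constructor <;> linarith [Int.floor_le (t a), Int.lt_floor_add_one (t a)]

theorem mem_cubeRegion_of_norm_add_one_le {r : ℝ} {t : ι → ℝ} (ht : ‖t‖ + 1 ≤ r) :
    t ∈ cubeRegion r := fun a => by
  obtain ⟨hlower, hupper⟩ := abs_le.1 (norm_le_pi_norm t a)
  rw [floorVec, abs_le]
  constructor <;> linarith [Int.floor_le (t a), Int.lt_floor_add_one (t a)]

theorem norm_sub_le_one_of_floorVec_eq {t u : ι → ℝ} (h : floorVec t = floorVec u) :
    ‖t - u‖ ≤ 1 :=
  (pi_norm_le_iff_of_nonneg zero_le_one).2 fun a =>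
    (Int.abs_sub_lt_one_of_floor_eq_floor (congrFun h a)).le

end Cubes

section Lattice

variable {q s : ℕ}

/-- The linear map `t ↦ ∑ a, t a • V a`, which parametrizes the span of the vectors `V a`. -/
noncomputable def latticeMap (V : Fin s → Fin q → ℤ) :
    (Fin s → ℝ) →ₗ[ℝ] EuclideanSpace ℝ (Fin q) :=
  Fintype.linearCombination ℝ fun a => intVec (V a)

/-- The count vectors `y` for which `y - λ` lies in the box with corner `w`. -/
def boxCounts (lam : Fin q → ℝ≥0) (V : Fin s → Fin q → ℤ) (w : Fin s → ℤ) : Set (Fin q → ℕ) :=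
  {y | countVec y - meanVec lam ∈ latticeBox V w}

/-- The integer vectors `y` for which `y - c` lies in the box with corner `w`. Unlike the count
vectors, they are permuted by the translations by the vectors `V a`. -/
def boxIntegers (c : EuclideanSpace ℝ (Fin q)) (V : Fin s → Fin q → ℤ) (w : Fin s → ℤ) :
    Set (Fin q → ℤ) :=
  {y | intVec y - c ∈ latticeBox V w}

variable (lam : Fin q → ℝ≥0) (c : EuclideanSpace ℝ (Fin q)) (V : Fin s → Fin q → ℤ)

theorem latticeMap_apply (t : Fin s → ℝ) : latticeMap V t = ∑ a, t a • intVec (V a) := rfl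

theorem range_latticeMap : LinearMap.range (latticeMap V) = latticeSpan V :=
  Fintype.range_linearCombination ℝ fun a => intVec (V a)

variable {V} in
theorem latticeMap_injective (hV : LinearIndependent ℝ fun a => intVec (V a)) :
    Function.Injective (latticeMap V) :=
  hV.fintypeLinearCombination_injective

theorem mem_latticeBox {w : Fin s → ℤ} {x : EuclideanSpace ℝ (Fin q)} :
    x ∈ latticeBox V w ↔ ∃ t, floorVec t = w ∧ latticeMap V t = x := by
  simp only [latticeBox, Set.mem_ofPred_eq, funext_iff, floorVec, latticeMap_apply,
    eq_comm (a := x)]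

theorem boxRegion_eq_image (r : ℝ) : boxRegion V r = latticeMap V '' cubeRegion r := by
  ext x
  simp only [boxRegion, Set.mem_iUnion₂, mem_latticeBox, cubeRegion, Set.mem_image]
  exact ⟨fun ⟨w, hw, t, hfloor, hx⟩ => ⟨t, by rw [← hfloor] at hw; exact hw, hx⟩,
    fun ⟨t, ht, hx⟩ => ⟨floorVec t, ht, t, rfl, hx⟩⟩

theorem latticeBox_subset_boxRegion {w : Fin s → ℤ} {r : ℝ} (hw : ∀ a, |(w a : ℝ)| ≤ r) :
    latticeBox V w ⊆ boxRegion V r :=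
  Set.subset_biUnion_of_mem (u := latticeBox V) (show w ∈ {w | ∀ a, |(w a : ℝ)| ≤ r} from hw)

theorem boxRegion_subset_latticeSpan (r : ℝ) :
    boxRegion V r ⊆ (latticeSpan V : Set (EuclideanSpace ℝ (Fin q))) := by
  rw [boxRegion_eq_image, ← range_latticeMap]
  exact Set.image_subset_range _ _

theorem latticeMap_add_mem_latticeBox {u : Fin s → ℤ} {x : EuclideanSpace ℝ (Fin q)}
    (hx : x ∈ latticeBox V u) (w : Fin s → ℤ) :
    x + latticeMap V (fun a => (w a : ℝ)) ∈ latticeBox V (u + w) := by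
  obtain ⟨t, rfl, rfl⟩ := (mem_latticeBox V).1 hx
  exact (mem_latticeBox V).2 ⟨_, floorVec_add_intCast t w, map_add _ _ _⟩

theorem add_sum_mem_boxIntegers {u : Fin s → ℤ} {y : Fin q → ℤ} (hy : y ∈ boxIntegers c V u)
    (w : Fin s → ℤ) : y + ∑ a, w a • V a ∈ boxIntegers c V (u + w) := by
  have hvec : intVec (y + ∑ a, w a • V a) = intVec y + latticeMap V fun a => (w a : ℝ) := by
    ext i
    simp [intVec, latticeMap_apply]
  rw [boxIntegers, Set.mem_ofPred_eq, hvec, add_sub_right_comm]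
  exact latticeMap_add_mem_latticeBox V hy w

theorem image_boxIntegers_zero (w : Fin s → ℤ) :
    (· + ∑ a, w a • V a) '' boxIntegers c V 0 = boxIntegers c V w := by
  ext y
  constructor
  · rintro ⟨y, hy, rfl⟩
    simpa using add_sum_mem_boxIntegers c V hy w
  · intro hy
    refine ⟨y - ∑ a, w a • V a, ?_, sub_add_cancel _ _⟩
    simpa [sub_eq_add_neg] using add_sum_mem_boxIntegers c V hy (-w)

theorem encard_boxIntegers (w : Fin s → ℤ) :
    (boxIntegers c V w).encard = (boxIntegers c V 0).encard := by
  rw [← image_boxIntegers_zero c V w, (add_left_injective _).encard_image]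

theorem nonempty_boxIntegers_zero (h : ∃ m : Fin q → ℤ, intVec m - c ∈ latticeSpan V) :
    (boxIntegers c V 0).Nonempty := by
  obtain ⟨m, hm⟩ := h
  rw [← range_latticeMap] at hm
  obtain ⟨t, ht⟩ := hm
  rw [← Set.image_nonempty, image_boxIntegers_zero c V (floorVec t)]
  exact ⟨m, (mem_latticeBox V).2 ⟨t, rfl, ht⟩⟩

variable {lam V} in
theorem encard_boxCounts {w : Fin s → ℤ} (hw : ∀ x ∈ latticeBox V w, ∀ i, -(lam i : ℝ) ≤ x i) :
    (boxCounts lam V w).encard = (boxIntegers (meanVec lam) V 0).encard := by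
  rw [← encard_boxIntegers _ V w, ← (Nat.cast_injective (R := ℤ)).comp_left.encard_image]
  congr 1
  ext y
  constructor
  · rintro ⟨y, hy, rfl⟩
    simpa [boxCounts, boxIntegers, countVec, intVec] using hy
  · intro hy
    have hnonneg : 0 ≤ y := fun i => by
      have := hw _ hy i
      simp only [intVec, meanVec, PiLp.sub_apply] at this
      exact_mod_cast (by linarith : (0 : ℝ) ≤ y i)
    lift y to Fin q → ℕ using hnonneg
    exact ⟨y, by simpa [boxCounts, boxIntegers, countVec, intVec] using hy, rfl⟩

variable {V}

theorem pairwiseDisjoint_boxCounts (hV : LinearIndependent ℝ fun a => intVec (V a))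
    (W : Set (Fin s → ℤ)) : W.PairwiseDisjoint (boxCounts lam V) := by
  refine fun w _ w' _ hne => Set.disjoint_left.2 fun y h h' => hne ?_
  obtain ⟨t, rfl, ht⟩ := (mem_latticeBox V).1 h
  obtain ⟨t', rfl, ht'⟩ := (mem_latticeBox V).1 h'
  rw [latticeMap_injective hV (ht.trans ht'.symm)]

theorem setLIntegral_boxRegion_poissonLaw (hV : LinearIndependent ℝ fun a => intVec (V a)) (r : ℝ)
    (f : (Fin q → ℕ) → ℝ≥0∞) :
    ∫⁻ y in {y | countVec y - meanVec lam ∈ boxRegion V r}, f y ∂(poissonLaw lam)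
      = ∫⁻ t in cubeRegion r, ∑' y : boxCounts lam V (floorVec t),
          f y * poissonLaw lam {(y : Fin q → ℕ)} := by
  have hregion : {y | countVec y - meanVec lam ∈ boxRegion V r}
      = ⋃ w ∈ {w : Fin s → ℤ | ∀ a, |(w a : ℝ)| ≤ r}, boxCounts lam V w := by
    ext y
    simp [boxRegion, boxCounts]
  rw [hregion, lintegral_biUnion (Set.to_countable _)
    (fun w _ => (Set.to_countable _).measurableSet) (pairwiseDisjoint_boxCounts lam hV _),
    setLIntegral_cubeRegion_comp_floorVec r fun w =>
      ∑' y : boxCounts lam V w, f y * poissonLaw lam {(y : Fin q → ℕ)}]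
  exact tsum_congr fun w => lintegral_countable _ (Set.to_countable _)

end Lattice

section TiltedGauss

open Filter Topology

/-- The Gaussian weight `exp (-β |x|² / 2)` tilted by `exp (g (|x|²))`. -/
noncomputable def tiltedGauss {G : Type*} [Norm G] (g : ℝ → ℝ) (β : ℝ) (x : G) : ℝ≥0∞ :=
  ENNReal.ofReal (Real.exp (g (‖x‖ ^ 2) - β * ‖x‖ ^ 2 / 2))

theorem tiltedGauss_le_mul {G : Type*} [Norm G] (g : ℝ → ℝ) {β β' c : ℝ} {x : G}
    (h : (β' - β) * ‖x‖ ^ 2 / 2 ≤ c) :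
    tiltedGauss g β x ≤ ENNReal.ofReal (Real.exp c) * tiltedGauss g β' x := by
  rw [tiltedGauss, tiltedGauss, ← ENNReal.ofReal_mul (Real.exp_pos _).le, ← Real.exp_add]
  exact ENNReal.ofReal_le_ofReal (Real.exp_le_exp.2 (by linarith))

theorem tiltedGauss_smul {G : Type*} [SeminormedAddCommGroup G] [NormedSpace ℝ G] (β c : ℝ)
    (x : G) : tiltedGauss 0 β (c • x) = tiltedGauss 0 (c ^ 2 * β) x := by
  simp only [tiltedGauss, norm_smul, Real.norm_eq_abs, mul_pow, sq_abs, Pi.zero_apply]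
  ring_nf

theorem setLIntegral_le_mul_setLIntegral {α : Type*} [MeasurableSpace α] (μ : Measure α)
    {S : Set α} (hS : MeasurableSet S) {f h : α → ℝ≥0∞} {c : ℝ}
    (hle : ∀ t ∈ S, f t ≤ ENNReal.ofReal c * h t) :
    ∫⁻ t in S, f t ∂μ ≤ ENNReal.ofReal c * ∫⁻ t in S, h t ∂μ :=
  (setLIntegral_mono' hS hle).trans_eq (lintegral_const_mul' _ _ ENNReal.ofReal_ne_top)

variable {F G : Type*} [NormedAddCommGroup F] [NormedSpace ℝ F] [FiniteDimensional ℝ F]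
  [MeasurableSpace F] [BorelSpace F] (μ : Measure F) [SeminormedAddCommGroup G] [NormedSpace ℝ G]

/-- The total mass of the Gaussian weight `exp (-|x|² / 2)` in the coordinates given by `Φ`. -/
noncomputable def gaussMass (Φ : F →ₗ[ℝ] G) : ℝ≥0∞ := ∫⁻ t, tiltedGauss 0 1 (Φ t) ∂μ

theorem measurableSet_norm_map_le (Φ : F →ₗ[ℝ] G) (R : ℝ) : MeasurableSet {t | ‖Φ t‖ ≤ R} :=
  (isClosed_le Φ.continuous_of_finiteDimensional.norm continuous_const).measurableSet

theorem setLIntegral_tiltedGauss_diff_le (g : ℝ → ℝ) {β β' r c : ℝ} (hr : 0 ≤ r) (hβ : β' ≤ β)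
    (hc : Real.exp (-((β - β') / 2 * r ^ 2)) ≤ c) (Φ : F →ₗ[ℝ] G) {T : Set F}
    (hT : MeasurableSet T) :
    ∫⁻ t in T \ {t | ‖Φ t‖ ≤ r}, tiltedGauss g β (Φ t) ∂μ
      ≤ ENNReal.ofReal c * ∫⁻ t in T, tiltedGauss g β' (Φ t) ∂μ := by
  refine (setLIntegral_le_mul_setLIntegral μ (hT.diff (measurableSet_norm_map_le Φ r))
    fun t ht => ?_).trans (mul_le_mul_right (lintegral_mono_set Set.sdiff_subset) _)
  have hsq : r ^ 2 ≤ ‖Φ t‖ ^ 2 :=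
    pow_le_pow_left₀ hr (not_le.1 (Set.notMem_ofPred_iff.1 ht.2)).le 2
  refine (tiltedGauss_le_mul g ?_).trans (by gcongr)
  have := mul_le_mul_of_nonneg_left hsq (by linarith : 0 ≤ (β - β') / 2)
  linarith

variable [μ.IsAddHaarMeasure]

theorem setLIntegral_comp_smul {c : ℝ} (hc : 0 < c) (f : F → ℝ≥0∞) (S : Set F) :
    ∫⁻ t in (c • ·) ⁻¹' S, f (c • t) ∂μ
      = ENNReal.ofReal ((c ^ Module.finrank ℝ F)⁻¹) * ∫⁻ t in S, f t ∂μ := by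
  have hsmul : MeasurableEmbedding fun t : F => c • t :=
    (MeasurableEquiv.smul₀ c hc.ne').measurableEmbedding
  rw [← hsmul.lintegral_map, ← hsmul.restrict_map, Measure.map_addHaar_smul μ hc.ne',
    Measure.restrict_smul, lintegral_smul_measure, smul_eq_mul, abs_of_pos (by positivity)]

theorem lintegral_tiltedGauss_sq {c : ℝ} (hc : 0 < c) (Φ : F →ₗ[ℝ] G) :
    ∫⁻ t, tiltedGauss 0 (c ^ 2) (Φ t) ∂μ
      = ENNReal.ofReal ((c ^ Module.finrank ℝ F)⁻¹) * gaussMass μ Φ := by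
  have := setLIntegral_comp_smul μ hc (fun t => tiltedGauss 0 1 (Φ t)) Set.univ
  simpa [tiltedGauss_smul, gaussMass] using this

theorem setLIntegral_tiltedGauss_tail_le (Φ : F →ₗ[ℝ] G) {R : ℝ} (hR : 0 ≤ R) :
    ∫⁻ t in {t | ‖Φ t‖ ≤ R}ᶜ, tiltedGauss 0 1 (Φ t) ∂μ
      ≤ ENNReal.ofReal (Real.exp (-(R ^ 2 / 4)) * ((√(1 / 2)) ^ Module.finrank ℝ F)⁻¹)
        * gaussMass μ Φ := by
  have hle : ∀ t ∈ {t | ‖Φ t‖ ≤ R}ᶜ, tiltedGauss 0 1 (Φ t)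
      ≤ ENNReal.ofReal (Real.exp (-(R ^ 2 / 4))) * tiltedGauss 0 (√(1 / 2) ^ 2) (Φ t) := by
    intro t ht
    have hsq : R ^ 2 ≤ ‖Φ t‖ ^ 2 :=
      pow_le_pow_left₀ hR (not_le.1 (Set.notMem_ofPred_iff.1 ht)).le 2
    -- Half of the exponent pays for the tail bound, the other half stays integrable.
    refine tiltedGauss_le_mul 0 ?_
    rw [Real.sq_sqrt (by norm_num)]
    linarith
  refine (setLIntegral_le_mul_setLIntegral μ (measurableSet_norm_map_le Φ R).compl hle).trans ?_
  rw [ENNReal.ofReal_mul (Real.exp_pos _).le, mul_assoc,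
    ← lintegral_tiltedGauss_sq μ (by positivity) Φ]
  gcongr
  exact Measure.restrict_le_self

theorem tendsto_exp_neg_mul_sq_atTop {c : ℝ} (hc : 0 < c) :
    Tendsto (fun R : ℝ => Real.exp (-(c * R ^ 2))) atTop (𝓝 0) :=
  Real.tendsto_exp_neg_atTop_nhds_zero.comp
    ((tendsto_pow_atTop two_ne_zero).const_mul_atTop hc)

theorem eventually_exp_mul_le (c : ℝ) {b : ℝ} (hb : 1 < b) :
    ∀ᶠ ε in 𝓝[>] (0 : ℝ), Real.exp (ε * c) ≤ b := by
  have hcont : Tendsto (fun ε => Real.exp (ε * c)) (𝓝[>] (0 : ℝ)) (𝓝 1) := by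
    have : ContinuousAt (fun ε => Real.exp (ε * c)) 0 := by fun_prop
    simpa using this.tendsto.mono_left nhdsWithin_le_nhds
  exact hcont.eventually_le_const hb

theorem eventually_gaussMass_le_mul_setLIntegral {a : ℝ} (ha : 1 < a) :
    ∀ᶠ R in atTop, ∀ Φ : F →ₗ[ℝ] G, gaussMass μ Φ ≠ ⊤ →
      gaussMass μ Φ ≤ ENNReal.ofReal a * ∫⁻ t in {t | ‖Φ t‖ ≤ R}, tiltedGauss 0 1 (Φ t) ∂μ := by
  have hainv : 0 < 1 - a⁻¹ := sub_pos.2 (inv_lt_one_of_one_lt₀ ha)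
  have htail : Tendsto (fun R : ℝ =>
      Real.exp (-(R ^ 2 / 4)) * ((√(1 / 2)) ^ Module.finrank ℝ F)⁻¹) atTop (𝓝 0) := by
    simpa [div_eq_inv_mul] using
      (tendsto_exp_neg_mul_sq_atTop (by norm_num : (0 : ℝ) < 4⁻¹)).mul_const
        ((√(1 / 2)) ^ Module.finrank ℝ F)⁻¹
  filter_upwards [htail.eventually_le_const hainv, eventually_ge_atTop 0] with R hRtail hR Φ hΦ
  have hsplit : gaussMass μ Φ ≤ ∫⁻ t in {t | ‖Φ t‖ ≤ R}, tiltedGauss 0 1 (Φ t) ∂μ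
      + ENNReal.ofReal (1 - a⁻¹) * gaussMass μ Φ := by
    nth_rewrite 1 [gaussMass]
    rw [← lintegral_add_compl _ (measurableSet_norm_map_le Φ R)]
    gcongr
    exact (setLIntegral_tiltedGauss_tail_le μ Φ hR).trans (by gcongr)
  have hmass : ENNReal.ofReal a⁻¹ * gaussMass μ Φ + ENNReal.ofReal (1 - a⁻¹) * gaussMass μ Φ
      = gaussMass μ Φ := by
    rw [← add_mul, ← ENNReal.ofReal_add (by positivity) hainv.le]
    simp
  have hinv : ENNReal.ofReal a⁻¹ * gaussMass μ Φ
      ≤ ∫⁻ t in {t | ‖Φ t‖ ≤ R}, tiltedGauss 0 1 (Φ t) ∂μ := by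
    have hfinite : ENNReal.ofReal (1 - a⁻¹) * gaussMass μ Φ ≠ ⊤ :=
      ENNReal.mul_ne_top ENNReal.ofReal_ne_top hΦ
    rwa [← ENNReal.add_le_add_iff_right hfinite, hmass]
  calc gaussMass μ Φ = ENNReal.ofReal a * (ENNReal.ofReal a⁻¹ * gaussMass μ Φ) := by
        rw [← mul_assoc, ← ENNReal.ofReal_mul (by positivity), mul_inv_cancel₀ (by positivity)]
        simp
    _ ≤ _ := by gcongr

theorem eventually_gaussMass_le_mul_setLIntegral_tiltedGauss {a : ℝ} (ha : 1 < a) :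
    ∀ᶠ R in atTop, ∀ᶠ ε in 𝓝[>] (0 : ℝ), ∀ (Φ : F →ₗ[ℝ] G) (T : Set F), gaussMass μ Φ ≠ ⊤ →
      {t | ‖Φ t‖ ≤ R} ⊆ T →
      gaussMass μ Φ ≤ ENNReal.ofReal a * ∫⁻ t in T, tiltedGauss 0 (1 + ε) (Φ t) ∂μ := by
  have hsqrt : 1 < √a := Real.lt_sqrt_of_sq_lt (by linarith)
  filter_upwards [eventually_gaussMass_le_mul_setLIntegral (G := G) μ hsqrt] with R hR
  filter_upwards [eventually_exp_mul_le (R ^ 2 / 2) hsqrt, self_mem_nhdsWithin]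
    with ε hexp hε Φ T hΦ hT
  have hball : ∫⁻ t in {t | ‖Φ t‖ ≤ R}, tiltedGauss 0 1 (Φ t) ∂μ
      ≤ ENNReal.ofReal √a * ∫⁻ t in {t | ‖Φ t‖ ≤ R}, tiltedGauss 0 (1 + ε) (Φ t) ∂μ := by
    refine setLIntegral_le_mul_setLIntegral μ (measurableSet_norm_map_le Φ R) fun t ht => ?_
    have hε0 : 0 ≤ ε := hε.le
    refine (tiltedGauss_le_mul 0 (c := ε * (R ^ 2 / 2)) ?_).trans (by gcongr)
    calc (1 + ε - 1) * ‖Φ t‖ ^ 2 / 2 = ε * (‖Φ t‖ ^ 2 / 2) := by ring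
      _ ≤ ε * (R ^ 2 / 2) := by gcongr; exact ht
  calc gaussMass μ Φ
      ≤ ENNReal.ofReal √a * ∫⁻ t in {t | ‖Φ t‖ ≤ R}, tiltedGauss 0 1 (Φ t) ∂μ := hR Φ hΦ
    _ ≤ ENNReal.ofReal √a * (ENNReal.ofReal √a * ∫⁻ t in T, tiltedGauss 0 (1 + ε) (Φ t) ∂μ) := by
        refine mul_le_mul_right (hball.trans ?_) _
        exact mul_le_mul_right (lintegral_mono_set hT) _
    _ = _ := by
        rw [← mul_assoc, ← ENNReal.ofReal_mul (by positivity), Real.mul_self_sqrt (by linarith)]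

theorem setLIntegral_tiltedGauss_one_le {g : ℝ → ℝ} (hg : MonotoneOn g (Set.Ici 0)) {θ : ℝ}
    (hθ : 1 ≤ θ) (Φ : F →ₗ[ℝ] G) (r : ℝ) :
    ∫⁻ t in {t | ‖Φ t‖ ≤ r}, tiltedGauss g 1 (Φ t) ∂μ
      ≤ ENNReal.ofReal ((θ ^ Module.finrank ℝ F)⁻¹)
        * ∫⁻ t in {t | ‖Φ t‖ ≤ θ * r}, tiltedGauss g (θ ^ 2)⁻¹ (Φ t) ∂μ := by
  have hθ0 : 0 < θ := by linarith
  have hpre : (θ • ·) ⁻¹' {t | ‖Φ t‖ ≤ θ * r} = {t | ‖Φ t‖ ≤ r} := by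
    ext t
    simp [norm_smul, abs_of_pos hθ0, mul_le_mul_iff_right₀ hθ0]
  rw [← setLIntegral_comp_smul μ hθ0, hpre]
  refine lintegral_mono fun t => ENNReal.ofReal_le_ofReal (Real.exp_le_exp.2 ?_)
  have hnorm : ‖Φ (θ • t)‖ ^ 2 = θ ^ 2 * ‖Φ t‖ ^ 2 := by
    rw [map_smul, norm_smul, Real.norm_of_nonneg hθ0.le, mul_pow]
  rw [hnorm, one_mul, inv_mul_cancel_left₀ (by positivity)]
  gcongr
  exact hg (Set.mem_Ici.2 (sq_nonneg _)) (Set.mem_Ici.2 (by positivity))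
    (le_mul_of_one_le_left (sq_nonneg _) (one_le_pow₀ hθ))

theorem setLIntegral_tiltedGauss_ball_le {g : ℝ → ℝ} (hg : MonotoneOn g (Set.Ici 0)) {θ : ℝ}
    (hθ : 1 ≤ θ) {ε b : ℝ} (hε : 0 ≤ ε) (r : ℝ) (hb : Real.exp (ε * (r ^ 2 / 2)) ≤ b)
    (Φ : F →ₗ[ℝ] G) :
    ∫⁻ t in {t | ‖Φ t‖ ≤ r}, tiltedGauss g (1 - ε) (Φ t) ∂μ
      ≤ ENNReal.ofReal (b * (θ ^ Module.finrank ℝ F)⁻¹)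
        * ∫⁻ t in {t | ‖Φ t‖ ≤ θ * r}, tiltedGauss g (θ ^ 2)⁻¹ (Φ t) ∂μ := by
  have hb0 : 0 ≤ b := (Real.exp_pos _).le.trans hb
  rw [ENNReal.ofReal_mul hb0, mul_assoc]
  refine (setLIntegral_le_mul_setLIntegral μ (measurableSet_norm_map_le Φ r) fun t ht => ?_).trans
    (mul_le_mul_right (setLIntegral_tiltedGauss_one_le μ hg hθ Φ r) _)
  refine (tiltedGauss_le_mul g (c := ε * (r ^ 2 / 2)) ?_).trans (by gcongr)
  calc (1 - (1 - ε)) * ‖Φ t‖ ^ 2 / 2 = ε * (‖Φ t‖ ^ 2 / 2) := by ring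
    _ ≤ ε * (r ^ 2 / 2) := by gcongr; exact ht

theorem eventually_setLIntegral_tiltedGauss_le {θ a : ℝ} (hθ : 1 < θ) (ha : 1 < a) :
    ∀ᶠ R in atTop, ∀ᶠ ε in 𝓝[>] (0 : ℝ), ∀ (g : ℝ → ℝ) (Φ : F →ₗ[ℝ] G) (T : Set F),
      MonotoneOn g (Set.Ici 0) → MeasurableSet T → {t | ‖Φ t‖ ≤ R} ⊆ T →
      ∫⁻ t in T, tiltedGauss g (1 - ε) (Φ t) ∂μ
        ≤ ENNReal.ofReal (a * (θ ^ Module.finrank ℝ F)⁻¹)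
          * ∫⁻ t in T, tiltedGauss g (θ ^ 2)⁻¹ (Φ t) ∂μ := by
  have hθ0 : 0 < θ := by linarith
  have hgap : 0 < 1 - (θ ^ 2)⁻¹ :=
    sub_pos.2 (inv_lt_one_of_one_lt₀ (one_lt_pow₀ hθ two_ne_zero))
  obtain ⟨b, hb1, hba⟩ := exists_between ha
  have hθd : 0 < (θ ^ Module.finrank ℝ F)⁻¹ := by positivity
  have htail : ∀ᶠ R in atTop, Real.exp (-((1 - (θ ^ 2)⁻¹) / 4 * (R / θ) ^ 2))
      ≤ (a - b) * (θ ^ Module.finrank ℝ F)⁻¹ :=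
    ((tendsto_exp_neg_mul_sq_atTop (by linarith)).comp
      (tendsto_id.atTop_div_const hθ0)).eventually_le_const (mul_pos (sub_pos.2 hba) hθd)
  filter_upwards [htail, eventually_ge_atTop 0] with R hRtail hR
  have hε_small : ∀ᶠ ε in 𝓝[>] (0 : ℝ), ε ≤ (1 - (θ ^ 2)⁻¹) / 2 :=
    nhdsWithin_le_nhds (eventually_le_nhds (by linarith))
  filter_upwards [eventually_exp_mul_le ((R / θ) ^ 2 / 2) hb1, hε_small, self_mem_nhdsWithin]
    with ε hexp hε hε0 g Φ T hg hT hRT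
  have hball : ∫⁻ t in {t | ‖Φ t‖ ≤ R / θ}, tiltedGauss g (1 - ε) (Φ t) ∂μ
      ≤ ENNReal.ofReal (b * (θ ^ Module.finrank ℝ F)⁻¹)
        * ∫⁻ t in T, tiltedGauss g (θ ^ 2)⁻¹ (Φ t) ∂μ := by
    refine (setLIntegral_tiltedGauss_ball_le μ hg hθ.le (le_of_lt hε0) _ hexp Φ).trans
      (mul_le_mul_right (lintegral_mono_set ?_) _)
    rwa [mul_div_cancel₀ _ hθ0.ne']
  have hrest : ∫⁻ t in T \ {t | ‖Φ t‖ ≤ R / θ}, tiltedGauss g (1 - ε) (Φ t) ∂μ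
      ≤ ENNReal.ofReal ((a - b) * (θ ^ Module.finrank ℝ F)⁻¹)
        * ∫⁻ t in T, tiltedGauss g (θ ^ 2)⁻¹ (Φ t) ∂μ := by
    refine setLIntegral_tiltedGauss_diff_le μ g (by positivity) (by linarith)
      (hRtail.trans' (Real.exp_le_exp.2 (neg_le_neg ?_))) Φ hT
    exact mul_le_mul_of_nonneg_right (by linarith) (sq_nonneg _)
  calc _ ≤ _ := lintegral_mono_set (Set.subset_union_right.trans_eq Set.union_sdiff_self.symm)
    _ ≤ _ := lintegral_union_le _ _ _
    _ ≤ _ := add_le_add hball hrest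
    _ = _ := by
        rw [← add_mul, ← ENNReal.ofReal_add (by positivity)
          (mul_nonneg (sub_nonneg.2 hba.le) hθd.le), ← add_mul, add_sub_cancel]

end TiltedGauss

section GaussianCoordinates

theorem lintegral_gaussian_density (E : Type*) [NormedAddCommGroup E] [InnerProductSpace ℝ E]
    [FiniteDimensional ℝ E] [MeasurableSpace E] [BorelSpace E] :
    ∫⁻ x : E, ENNReal.ofReal ((2 * Real.pi) ^ (-(Module.finrank ℝ E : ℝ) / 2)
      * Real.exp (-‖x‖ ^ 2 / 2)) = 1 := by
  have hintegral : ∫ x : E, (2 * Real.pi) ^ (-(Module.finrank ℝ E : ℝ) / 2)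
      * Real.exp (-‖x‖ ^ 2 / 2) = 1 := by
    have hgauss := GaussianFourier.integral_rexp_neg_mul_sq_norm (V := E) one_half_pos
    simp_rw [integral_const_mul, neg_div, div_eq_inv_mul, ← neg_mul, inv_eq_one_div]
    rw [hgauss, div_div_eq_mul_div, div_one, mul_comm Real.pi,
      ← Real.rpow_add Real.two_pi_pos, neg_mul, one_div_mul_eq_div, neg_add_cancel, Real.rpow_zero]
  rw [← ofReal_integral_eq_lintegral_ofReal, hintegral, ENNReal.ofReal_one]
  · exact .of_integral_ne_zero (by rw [hintegral]; exact one_ne_zero)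
  · exact Filter.Eventually.of_forall fun x => by positivity

variable {F : Type*} [NormedAddCommGroup F] [NormedSpace ℝ F] [MeasurableSpace F]
  [BorelSpace F] (μ : Measure F) [μ.IsAddHaarMeasure]

theorem exists_lintegral_gaussian_density_eq_mul {E : Type*} [NormedAddCommGroup E]
    [InnerProductSpace ℝ E] [FiniteDimensional ℝ E] [MeasurableSpace E] [BorelSpace E]
    (e : F ≃L[ℝ] E) {κ : ℝ} (hκ : 0 ≤ κ) :
    ∃ c : ℝ≥0∞, ∀ f : E → ℝ≥0∞, ∫⁻ x, ENNReal.ofReal (κ * Real.exp (-‖x‖ ^ 2 / 2)) * f x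
      = c * ∫⁻ t, tiltedGauss 0 1 (e t) * f (e t) ∂μ := by
  have : (μ.map e).IsAddHaarMeasure := e.isAddHaarMeasure_map μ
  obtain ⟨c, hc⟩ : ∃ c : ℝ≥0, (volume : Measure E) = c • μ.map e :=
    ⟨_, Measure.isAddLeftInvariant_eq_smul _ _⟩
  refine ⟨c * ENNReal.ofReal κ, fun f => ?_⟩
  have he : MeasurableEmbedding e := e.toHomeomorph.measurableEmbedding
  rw [hc, lintegral_smul_measure, he.lintegral_map, ENNReal.smul_def, smul_eq_mul, mul_assoc,
    ← lintegral_const_mul' _ _ ENNReal.ofReal_ne_top]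
  simp_rw [ENNReal.ofReal_mul hκ, mul_assoc, tiltedGauss, Pi.zero_apply, zero_sub, one_mul,
    neg_div]

variable {q : ℕ}

theorem lintegral_subspaceGaussian (E : Submodule ℝ (EuclideanSpace ℝ (Fin q)))
    (f : EuclideanSpace ℝ (Fin q) → ℝ≥0∞) :
    ∫⁻ x, f x ∂(subspaceGaussian E)
      = ∫⁻ x : E, ENNReal.ofReal ((2 * Real.pi) ^ (-(Module.finrank ℝ E : ℝ) / 2)
          * Real.exp (-‖x‖ ^ 2 / 2)) * f x := by
  have hval : MeasurableEmbedding (Subtype.val : E → EuclideanSpace ℝ (Fin q)) :=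
    .subtype_coe (Submodule.closed_of_finiteDimensional E).measurableSet
  rw [subspaceGaussian, hval.lintegral_map, OrthonormalBasis.addHaar_eq_volume,
    lintegral_withDensity_eq_lintegral_mul_non_measurable _ (by fun_prop)
      (Filter.Eventually.of_forall fun _ => ENNReal.ofReal_lt_top)]
  rfl

variable [FiniteDimensional ℝ F] {Φ : F →ₗ[ℝ] EuclideanSpace ℝ (Fin q)}

theorem exists_gaussMass_mul_eq_one (hΦ : Function.Injective Φ) :
    ∃ c : ℝ≥0∞, c * gaussMass μ Φ = 1 ∧ ∀ f : EuclideanSpace ℝ (Fin q) → ℝ≥0∞,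
      ∫⁻ x, f x ∂(subspaceGaussian (LinearMap.range Φ))
        = c * ∫⁻ t, tiltedGauss 0 1 (Φ t) * f (Φ t) ∂μ := by
  obtain ⟨c, hc⟩ := exists_lintegral_gaussian_density_eq_mul μ
    (LinearEquiv.ofInjective Φ hΦ).toContinuousLinearEquiv
    (κ := (2 * Real.pi) ^ (-(Module.finrank ℝ (LinearMap.range Φ) : ℝ) / 2)) (by positivity)
  refine ⟨c, ?_, fun f => by rw [lintegral_subspaceGaussian, hc fun x => f x]; rfl⟩
  have hone := hc fun _ => 1
  simp only [mul_one] at hone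
  rw [lintegral_gaussian_density] at hone
  exact hone.symm

theorem gaussMass_ne_zero (hΦ : Function.Injective Φ) : gaussMass μ Φ ≠ 0 := by
  obtain ⟨c, hc, -⟩ := exists_gaussMass_mul_eq_one μ hΦ
  exact right_ne_zero_of_mul_eq_one hc

theorem gaussMass_ne_top (hΦ : Function.Injective Φ) : gaussMass μ Φ ≠ ⊤ := by
  obtain ⟨c, hc, -⟩ := exists_gaussMass_mul_eq_one μ hΦ
  intro htop
  have := left_ne_zero_of_mul_eq_one hc
  simp [htop, this] at hc

theorem lintegral_subspaceGaussian_range (hΦ : Function.Injective Φ)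
    (f : EuclideanSpace ℝ (Fin q) → ℝ≥0∞) :
    ∫⁻ x, f x ∂(subspaceGaussian (LinearMap.range Φ))
      = (gaussMass μ Φ)⁻¹ * ∫⁻ t, tiltedGauss 0 1 (Φ t) * f (Φ t) ∂μ := by
  obtain ⟨c, hc, hf⟩ := exists_gaussMass_mul_eq_one μ hΦ
  rw [hf, ENNReal.eq_inv_of_mul_eq_one_left hc]

end GaussianCoordinates

section Modulus

open Filter Topology

theorem exists_dist_le_add_mul_dist {E X : Type*} [SeminormedAddCommGroup E] [NormedSpace ℝ E]
    [PseudoMetricSpace X] {f : E → X} {S : Set E} (hS : Convex ℝ S)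
    (hf : UniformContinuousOn f S) {ε : ℝ} (hε : 0 < ε) :
    ∃ K > 0, ∀ x ∈ S, ∀ y ∈ S, dist (f x) (f y) ≤ ε + K * dist x y := by
  obtain ⟨d, hd, hfd⟩ := Metric.uniformContinuousOn_iff_le.1 hf ε hε
  refine ⟨ε / d, by positivity, fun x hx y hy => ?_⟩
  set n := ⌊dist x y / d⌋₊
  -- Subdivide the segment from `x` to `y` into `n + 1` pieces of length at most `d`.
  let p : ℕ → E := fun k => AffineMap.lineMap x y (k / (n + 1) : ℝ)
  have hp : ∀ k ≤ n + 1, p k ∈ S := fun k hk =>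
    hS.lineMap_mem hx hy ⟨by positivity, (div_le_one (by positivity)).2 (mod_cast hk)⟩
  have hstep : ∀ k, dist (p k) (p (k + 1)) ≤ d := fun k => by
    have hn : dist x y < (n + 1) * d := (div_lt_iff₀ hd).1 (Nat.lt_floor_add_one _)
    have hk : (k / (n + 1) - (k + 1) / (n + 1) : ℝ) = -(1 / (n + 1)) := by ring
    rw [dist_lineMap_lineMap, Real.dist_eq, Nat.cast_succ, hk, abs_neg,
      abs_of_pos (by positivity), one_div_mul_eq_div, div_le_iff₀ (by positivity), mul_comm d]
    exact hn.le
  calc dist (f x) (f y) = dist (f (p 0)) (f (p (n + 1))) := by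
        simp [p, div_self (Nat.cast_add_one_ne_zero (R := ℝ) n)]
    _ ≤ ∑ _k ∈ Finset.range (n + 1), ε :=
        dist_le_range_sum_of_dist_le (f := f ∘ p) _ fun {k} hk =>
          hfd _ (hp k (by omega)) _ (hp (k + 1) (by omega)) (hstep k)
    _ = ε + ε * n := by rw [Finset.sum_const, Finset.card_range, nsmul_eq_mul]; push_cast; ring
    _ ≤ ε + ε * (dist x y / d) := by gcongr; exact Nat.floor_le (by positivity)
    _ = ε + ε / d * dist x y := by ring

theorem abs_sq_sub_sq_le {m n ρ : ℝ} (hρ : ρ ≤ 1) (h : |m - n| ≤ ρ) :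
    |m ^ 2 - n ^ 2| ≤ 2 * ρ * (1 + n ^ 2) := by
  have hsum : |m + n| ≤ 2 * (1 + n ^ 2) := by
    rw [abs_le] at h ⊢
    constructor <;> nlinarith [sq_nonneg (n - 1), sq_nonneg (n + 1)]
  calc |m ^ 2 - n ^ 2| = |m - n| * |m + n| := by rw [← abs_mul]; ring_nf
    _ ≤ ρ * (2 * (1 + n ^ 2)) := mul_le_mul h hsum (abs_nonneg _) ((abs_nonneg _).trans h)
    _ = 2 * ρ * (1 + n ^ 2) := by ring

theorem eventually_abs_comp_sq_sub_le {g : ℝ → ℝ} (hg : UniformContinuousOn g (Set.Ici 0))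
    {ε : ℝ} (hε : 0 < ε) :
    ∀ᶠ ρ in 𝓝[>] (0 : ℝ), ∀ m n : ℝ, |m - n| ≤ ρ →
      |g (m ^ 2) - g (n ^ 2)| ≤ ε * (1 + n ^ 2) := by
  obtain ⟨K, hK, hgK⟩ := exists_dist_le_add_mul_dist (convex_Ici 0) hg (half_pos hε)
  have hsmall : Set.Ioc 0 (min 1 (ε / (4 * K))) ∈ 𝓝[>] (0 : ℝ) :=
    Ioc_mem_nhdsGT (by positivity)
  filter_upwards [hsmall] with ρ ⟨_, hρ⟩ m n hmn
  have hρK : ρ * (4 * K) ≤ ε := (le_div_iff₀ (by positivity)).1 (hρ.trans (min_le_right _ _))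
  calc |g (m ^ 2) - g (n ^ 2)| ≤ ε / 2 + K * |m ^ 2 - n ^ 2| :=
        hgK _ (sq_nonneg m) _ (sq_nonneg n)
    _ ≤ ε / 2 + K * (2 * ρ * (1 + n ^ 2)) := by
        gcongr; exact abs_sq_sub_sq_le (hρ.trans (min_le_left _ _)) hmn
    _ ≤ ε * (1 + n ^ 2) := by nlinarith [sq_nonneg n]

theorem upper_exponent_le {ε ε' m n gm gn : ℝ} (hε : 0 ≤ ε) (hε1 : ε ≤ 1) (hε' : 4 * ε ≤ ε')
    (hsq : |m ^ 2 - n ^ 2| ≤ ε * (1 + n ^ 2)) (hg : |gm - gn| ≤ ε * (1 + n ^ 2)) :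
    gm + (ε - (1 - ε) * m ^ 2 / 2) ≤ ε' + (gn - (1 - ε') * n ^ 2 / 2) := by
  have hn := mul_le_mul_of_nonneg_right hε' (sq_nonneg n)
  nlinarith [mul_le_mul_of_nonneg_left (abs_le.1 hsq).1 (sub_nonneg.2 hε1), (abs_le.1 hg).2,
    mul_nonneg (mul_nonneg hε hε) (sq_nonneg n), mul_nonneg hε hε]

theorem le_lower_exponent {ε ε' m n : ℝ} (hε : 0 ≤ ε) (hε1 : ε ≤ 1) (hε' : 4 * ε ≤ ε')
    (hsq : |m ^ 2 - n ^ 2| ≤ ε * (1 + n ^ 2)) :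
    -ε' - (1 + ε') * n ^ 2 / 2 ≤ -ε - (1 + ε) * m ^ 2 / 2 := by
  have hn := mul_le_mul_of_nonneg_right hε' (sq_nonneg n)
  nlinarith [mul_le_mul_of_nonneg_left (abs_le.1 hsq).2 (by linarith : 0 ≤ 1 + ε),
    mul_nonneg (mul_nonneg hε (sub_nonneg.2 hε1)) (sq_nonneg n),
    mul_nonneg hε (sub_nonneg.2 hε1), mul_nonneg hε (sq_nonneg n)]

end Modulus

section Standardization

variable {q s : ℕ} (lam : Fin q → ℝ≥0) (V : Fin s → Fin q → ℤ)

theorem totalMean_nonneg : 0 ≤ totalMean lam :=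
  Finset.sum_nonneg fun i _ => (lam i).2

variable {lam} in
theorem norm_invD_le {m : ℝ} (hm : 0 < m) (h : ∀ i, m ≤ lam i) (x : EuclideanSpace ℝ (Fin q)) :
    ‖invD lam x‖ ≤ ‖x‖ / √m := by
  refine le_of_sq_le_sq ?_ (by positivity)
  rw [norm_invD_sq, div_pow, Real.sq_sqrt hm.le, EuclideanSpace.norm_sq_eq, Finset.sum_div]
  simp only [Real.norm_eq_abs, sq_abs]
  gcongr with i
  exact h i

variable {lam} in
theorem norm_le_sqrt_totalMean_mul_norm_invD (h : ∀ i, 0 < lam i)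
    (x : EuclideanSpace ℝ (Fin q)) : ‖x‖ ≤ √(totalMean lam) * ‖invD lam x‖ := by
  refine le_of_sq_le_sq ?_ (by positivity)
  rw [mul_pow, norm_invD_sq, Real.sq_sqrt (totalMean_nonneg lam), EuclideanSpace.norm_sq_eq,
    Finset.mul_sum]
  gcongr with i
  have hlam : (0 : ℝ) < lam i := h i
  have hle : (lam i : ℝ) ≤ totalMean lam :=
    Finset.single_le_sum (f := fun i => (lam i : ℝ)) (fun i _ => (lam i).2) (Finset.mem_univ i)
  calc ‖x i‖ ^ 2 = lam i * (x i ^ 2 / lam i) := by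
        rw [mul_div_cancel₀ _ hlam.ne', Real.norm_eq_abs, sq_abs]
    _ ≤ totalMean lam * (x i ^ 2 / lam i) := by gcongr

variable {lam} in
theorem invD_injective (h : ∀ i, 0 < lam i) : Function.Injective (invD lam) := by
  refine (injective_iff_map_eq_zero _).2 fun x hx => norm_le_zero_iff.1 ?_
  simpa [hx] using norm_le_sqrt_totalMean_mul_norm_invD h x

/-- The map `t ↦ D⁻¹ ∑ a, t a • V a`, which parametrizes `D⁻¹ L`. -/
noncomputable def stdLatticeMap : (Fin s → ℝ) →ₗ[ℝ] EuclideanSpace ℝ (Fin q) :=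
  invD lam ∘ₗ latticeMap V

variable {lam V} in
theorem stdLatticeMap_injective (hV : LinearIndependent ℝ fun a => intVec (V a))
    (h : ∀ i, 0 < lam i) : Function.Injective (stdLatticeMap lam V) :=
  (invD_injective h).comp (latticeMap_injective hV)

theorem range_stdLatticeMap :
    LinearMap.range (stdLatticeMap lam V) = (latticeSpan V).map (invD lam) := by
  rw [stdLatticeMap, LinearMap.range_comp, range_latticeMap]

theorem invD_image_boxRegion (r : ℝ) :
    invD lam '' boxRegion V r = stdLatticeMap lam V '' cubeRegion r := by
  rw [boxRegion_eq_image, Set.image_image]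
  rfl

variable {lam V} in
theorem map_latticeSpan_inter_subset_image_boxRegion {r R : ℝ}
    (h : {t | ‖stdLatticeMap lam V t‖ ≤ R} ⊆ cubeRegion r) :
    {x | x ∈ (latticeSpan V).map (invD lam) ∧ ‖x‖ ≤ R} ⊆ invD lam '' boxRegion V r := by
  rintro x ⟨hx, hR⟩
  rw [← range_stdLatticeMap] at hx
  obtain ⟨t, rfl⟩ := hx
  exact invD_image_boxRegion lam V r ▸ Set.mem_image_of_mem _ (h hR)

variable {lam V} in
theorem abs_norm_stdVec_sub_norm_le {ρ : ℝ} (hρ : 0 ≤ ρ)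
    (hΦ : ∀ t, ‖stdLatticeMap lam V t‖ ≤ ρ * ‖t‖) {t : Fin s → ℝ} {y : Fin q → ℕ}
    (hy : y ∈ boxCounts lam V (floorVec t)) :
    |‖stdVec lam y‖ - ‖stdLatticeMap lam V t‖| ≤ ρ := by
  obtain ⟨u, hut, hu⟩ := (mem_latticeBox V).1 hy
  have hstd : stdVec lam y = stdLatticeMap lam V u := by
    rw [stdVec, ← hu, stdLatticeMap, LinearMap.comp_apply]
  calc |‖stdVec lam y‖ - ‖stdLatticeMap lam V t‖|
      ≤ ‖stdLatticeMap lam V (u - t)‖ := by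
        rw [hstd, map_sub]; exact abs_norm_sub_norm_le _ _
    _ ≤ ρ * ‖u - t‖ := hΦ _
    _ ≤ ρ * 1 := by gcongr; exact norm_sub_le_one_of_floorVec_eq hut
    _ = ρ := mul_one ρ

variable {lam V} in
theorem abs_count_sub_mean_le {δ r : ℝ}
    (hδ : ∀ t ∈ cubeRegion r, ∀ i, |latticeMap V t i| ≤ δ * lam i) {t : Fin s → ℝ}
    (ht : t ∈ cubeRegion r) {y : Fin q → ℕ} (hy : y ∈ boxCounts lam V (floorVec t)) (i : Fin q) :
    |(y i : ℝ) - lam i| ≤ δ * lam i := by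
  obtain ⟨u, hut, hu⟩ := (mem_latticeBox V).1 hy
  have hur : u ∈ cubeRegion r := fun a => hut ▸ ht a
  simpa [hu, countVec, meanVec] using hδ u hur i

end Standardization

section LargeMeans

open Filter

variable {q s : ℕ} {τ : ℝ}

/-- The filter along which the limit theorem is taken: the total mean tends to infinity, while
every mean stays above the fraction `τ` of it. -/
def largeMeans (τ : ℝ) : Filter (Fin q → ℝ≥0) :=
  comap totalMean atTop ⊓ 𝓟 {lam | ∀ i, τ * totalMean lam ≤ lam i}

theorem eventually_largeMeans_iff {p : (Fin q → ℝ≥0) → Prop} :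
    (∀ᶠ lam in largeMeans τ, p lam) ↔ ∃ ν₀ : ℝ, ∀ lam, ν₀ ≤ totalMean lam →
      (∀ i, τ * totalMean lam ≤ lam i) → p lam := by
  simp only [largeMeans, eventually_inf_principal, eventually_comap, eventually_atTop]
  exact ⟨fun ⟨ν₀, h⟩ => ⟨ν₀, fun lam hν => h _ hν lam rfl⟩,
    fun ⟨ν₀, h⟩ => ⟨ν₀, fun _ hν lam heq => h lam (heq ▸ hν)⟩⟩

theorem tendsto_totalMean_largeMeans :
    Tendsto (totalMean : (Fin q → ℝ≥0) → ℝ) (largeMeans τ) atTop :=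
  tendsto_comap.mono_left inf_le_left

theorem eventually_mul_totalMean_le :
    ∀ᶠ lam : Fin q → ℝ≥0 in largeMeans τ, ∀ i, τ * totalMean lam ≤ lam i :=
  mem_inf_of_right (mem_principal_self _)

theorem eventually_le_mean (hτ : 0 < τ) (M : ℝ) :
    ∀ᶠ lam : Fin q → ℝ≥0 in largeMeans τ, ∀ i, M ≤ lam i := by
  filter_upwards [eventually_mul_totalMean_le,
    (tendsto_totalMean_largeMeans.const_mul_atTop hτ).eventually_ge_atTop M] with lam hlam hM i
  exact hM.trans (hlam i)

theorem eventually_mean_pos (hτ : 0 < τ) : ∀ᶠ lam : Fin q → ℝ≥0 in largeMeans τ, ∀ i, 0 < lam i :=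
  (eventually_le_mean hτ 1).mono fun _ h i => NNReal.coe_pos.1 (one_pos.trans_le (h i))

theorem eventually_norm_stdLatticeMap_le (hτ : 0 < τ) (V : Fin s → Fin q → ℤ) {ρ : ℝ}
    (hρ : 0 < ρ) : ∀ᶠ lam in largeMeans τ, ∀ t, ‖stdLatticeMap lam V t‖ ≤ ρ * ‖t‖ := by
  obtain ⟨K, hK, hVK⟩ := (latticeMap V).toContinuousLinearMap.bound
  filter_upwards [eventually_le_mean hτ ((K / ρ) ^ 2)] with lam hlam t
  calc ‖stdLatticeMap lam V t‖ ≤ ‖latticeMap V t‖ / √((K / ρ) ^ 2) :=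
        norm_invD_le (by positivity) hlam _
    _ ≤ K * ‖t‖ / (K / ρ) := by
        rw [Real.sqrt_sq (by positivity)]; gcongr; exact hVK t
    _ = ρ * ‖t‖ := by field_simp

theorem exists_eventually_abs_latticeMap_le (hτ : 0 < τ) (V : Fin s → Fin q → ℤ) {δ : ℝ}
    (hδ : 0 < δ) :
    ∃ η > 0, ∀ᶠ lam in largeMeans τ, ∀ t ∈ cubeRegion (η * totalMean lam), ∀ i,
      |latticeMap V t i| ≤ δ * lam i := by
  obtain ⟨K, hK, hVK⟩ := (latticeMap V).toContinuousLinearMap.bound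
  have hη : 0 < δ * τ / (2 * K) := by positivity
  refine ⟨_, hη, ?_⟩
  filter_upwards [eventually_mul_totalMean_le,
    (tendsto_totalMean_largeMeans.const_mul_atTop hη).eventually_ge_atTop 1] with lam hlam hν t ht i
  calc |latticeMap V t i| ≤ ‖latticeMap V t‖ := PiLp.norm_apply_le (latticeMap V t) i
    _ ≤ K * ‖t‖ := hVK t
    _ ≤ K * (2 * (δ * τ / (2 * K) * totalMean lam)) := by
        gcongr; linarith [norm_le_of_mem_cubeRegion (zero_le_one.trans hν) ht]
    _ = δ * (τ * totalMean lam) := by field_simp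
    _ ≤ δ * lam i := by gcongr; exact hlam i

theorem exists_eventually_subset_cubeRegion (hτ : 0 < τ) {V : Fin s → Fin q → ℤ}
    (hV : LinearIndependent ℝ fun a => intVec (V a)) {η : ℝ} (hη : 0 < η) :
    ∃ δ > 0, ∀ᶠ lam in largeMeans τ,
      {t | ‖stdLatticeMap lam V t‖ ≤ δ * √(totalMean lam)} ⊆ cubeRegion (η * totalMean lam) := by
  obtain ⟨K, hK, hVK⟩ := (latticeMap V).exists_antilipschitzWith
    (LinearMap.ker_eq_bot.2 (latticeMap_injective hV))
  have : (0 : ℝ) < K := hK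
  refine ⟨η / (2 * K), by positivity, ?_⟩
  filter_upwards [eventually_mean_pos hτ,
    (tendsto_totalMean_largeMeans.const_mul_atTop hη).eventually_ge_atTop 2]
    with lam hlam hν t (ht : ‖stdLatticeMap lam V t‖ ≤ _)
  refine mem_cubeRegion_of_norm_add_one_le ?_
  calc ‖t‖ + 1 ≤ K * ‖latticeMap V t‖ + 1 := by
        gcongr; simpa using hVK.le_mul_dist t 0
    _ ≤ K * (√(totalMean lam) * (η / (2 * K) * √(totalMean lam))) + 1 := by
        gcongr; exact (norm_le_sqrt_totalMean_mul_norm_invD hlam _).trans (by gcongr; exact ht)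
    _ = η * (√(totalMean lam) * √(totalMean lam)) / 2 + 1 := by field_simp
    _ ≤ η * totalMean lam := by
        rw [Real.mul_self_sqrt (totalMean_nonneg lam)]; linarith

theorem eventually_le_mul_sqrt_totalMean {δ : ℝ} (hδ : 0 < δ) (R : ℝ) :
    ∀ᶠ lam : Fin q → ℝ≥0 in largeMeans τ, R ≤ δ * √(totalMean lam) :=
  ((Real.tendsto_sqrt_atTop.comp tendsto_totalMean_largeMeans).const_mul_atTop
    hδ).eventually_ge_atTop R

end LargeMeans

section LocalLimit

open Filter

variable {q s : ℕ}

/-- The local limit theorem on the boxes indexed by `‖w‖ ≤ r`, with relative error `exp (± ε)` and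
with the Gaussian variance perturbed by the factor `1 ± ε`: for a count vector `y` with `y - λ` in
the box of a point `∑ a, t a • V a`, the probability of `y`, on the upper side weighted by
`exp (g (|X|²))`, is compared with the value of the Gaussian weight at `t`. By `neg_mean_le`, every
integer vector `y` with `y - λ` in the region is a count vector. -/
structure IsBoxLocalLimit (lam : Fin q → ℝ≥0) (V : Fin s → Fin q → ℤ) (g : ℝ → ℝ) (r ε : ℝ) :
    Prop where
  neg_mean_le : ∀ x ∈ boxRegion V r, ∀ i, -(lam i : ℝ) ≤ x i
  upper : ∀ t ∈ cubeRegion r, ∀ y ∈ boxCounts lam V (floorVec t),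
    ENNReal.ofReal (Real.exp (g (‖stdVec lam y‖ ^ 2))) * poissonLaw lam {y}
      ≤ ENNReal.ofReal (gaussNorm lam * Real.exp ε)
        * tiltedGauss g (1 - ε) (stdLatticeMap lam V t)
  lower : ∀ t ∈ cubeRegion r, ∀ y ∈ boxCounts lam V (floorVec t),
    ENNReal.ofReal (gaussNorm lam * Real.exp (-ε))
        * tiltedGauss 0 (1 + ε) (stdLatticeMap lam V t)
      ≤ poissonLaw lam {y}

theorem neg_mean_le_of_abs_latticeMap_le {lam : Fin q → ℝ≥0} {V : Fin s → Fin q → ℤ} {δ r : ℝ}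
    (hδ1 : δ ≤ 1) (hδ : ∀ t ∈ cubeRegion r, ∀ i, |latticeMap V t i| ≤ δ * lam i)
    {x : EuclideanSpace ℝ (Fin q)} (hx : x ∈ boxRegion V r) (i : Fin q) :
    -(lam i : ℝ) ≤ x i := by
  rw [boxRegion_eq_image] at hx
  obtain ⟨t, ht, rfl⟩ := hx
  exact neg_le_of_abs_le ((hδ t ht i).trans (mul_le_of_le_one_left (lam i).2 hδ1))

theorem exists_eventually_isBoxLocalLimit {τ : ℝ} (hτ : 0 < τ) (V : Fin s → Fin q → ℤ) {g : ℝ → ℝ}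
    (hg : UniformContinuousOn g (Set.Ici 0)) {ε : ℝ} (hε : 0 < ε) :
    ∃ η > 0, ∀ᶠ lam in largeMeans τ, IsBoxLocalLimit lam V g (η * totalMean lam) ε := by
  obtain ⟨ε', hε', hε'1, hε'ε⟩ : ∃ ε' : ℝ, 0 < ε' ∧ ε' ≤ 1 ∧ 4 * ε' ≤ ε :=
    ⟨min 1 (ε / 4), by positivity, min_le_left _ _, by linarith [min_le_right 1 (ε / 4)]⟩
  obtain ⟨δ, hδ, M, hpoisson⟩ := exists_poissonLaw_singleton_bounds q hε'
  obtain ⟨ρ, ⟨hgρ, hsqρ⟩, hρ : 0 < ρ⟩ := (((eventually_abs_comp_sq_sub_le hg hε').and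
    (eventually_abs_comp_sq_sub_le uniformContinuous_id.uniformContinuousOn hε')).and
    self_mem_nhdsWithin).exists
  obtain ⟨η, hη, hlattice⟩ := exists_eventually_abs_latticeMap_le hτ V (lt_min hδ one_pos)
  refine ⟨η, hη, ?_⟩
  filter_upwards [hlattice, eventually_le_mean hτ M, eventually_mean_pos hτ,
    eventually_norm_stdLatticeMap_le hτ V hρ] with lam hlattice hM hpos hΦ
  have hG := gaussNorm_pos hpos
  have hbounds : ∀ t ∈ cubeRegion (η * totalMean lam), ∀ y ∈ boxCounts lam V (floorVec t), _ :=
    fun t ht y hy => hpoisson lam y hM fun i =>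
      (abs_count_sub_mean_le hlattice ht hy i).trans (by gcongr; exact min_le_left _ _)
  refine ⟨fun x hx => neg_mean_le_of_abs_latticeMap_le (min_le_right _ _) hlattice hx,
    fun t ht y hy => ?_, fun t ht y hy => ?_⟩
  all_goals
    have hnorm := abs_norm_stdVec_sub_norm_le hρ.le hΦ hy
    have hsq := hsqρ _ _ hnorm
  · refine (mul_le_mul_right (hbounds t ht y hy).2 _).trans ?_
    rw [tiltedGauss, ← ENNReal.ofReal_mul (by positivity), ← ENNReal.ofReal_mul (by positivity),
      mul_left_comm, mul_assoc, ← Real.exp_add, ← Real.exp_add]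
    exact ENNReal.ofReal_le_ofReal (mul_le_mul_of_nonneg_left (Real.exp_le_exp.2
      (upper_exponent_le hε'.le hε'1 hε'ε hsq (hgρ _ _ hnorm))) hG.le)
  · refine le_trans ?_ (hbounds t ht y hy).1
    rw [tiltedGauss, ← ENNReal.ofReal_mul (by positivity), mul_assoc, ← Real.exp_add,
      Pi.zero_apply, zero_sub, ← sub_eq_add_neg]
    exact ENNReal.ofReal_le_ofReal (mul_le_mul_of_nonneg_left (Real.exp_le_exp.2
      (le_lower_exponent hε'.le hε'1 hε'ε hsq)) hG.le)

end LocalLimit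

section Comparison

variable {q s : ℕ} {lam : Fin q → ℝ≥0} {V : Fin s → Fin q → ℤ}

theorem setLIntegral_condLaw_le_inv_mul (lam : Fin q → ℝ≥0)
    (L : Submodule ℝ (EuclideanSpace ℝ (Fin q))) (S : Set (Fin q → ℕ)) (f : (Fin q → ℕ) → ℝ≥0∞) :
    ∫⁻ y in S, f y ∂(condLaw lam L)
      ≤ (poissonLaw lam (linearEvent lam L))⁻¹ * ∫⁻ y in S, f y ∂(poissonLaw lam) := by
  rw [condLaw, ProbabilityTheory.cond, Measure.restrict_smul, lintegral_smul_measure, smul_eq_mul]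
  gcongr
  exact Measure.restrict_le_self

theorem le_setLIntegral_limitNormal (hΦ : Function.Injective (stdLatticeMap lam V)) (g : ℝ → ℝ)
    {θ : ℝ} (hθ : 0 < θ) (r : ℝ) :
    (gaussMass volume (stdLatticeMap lam V))⁻¹ * (ENNReal.ofReal ((θ ^ s)⁻¹)
        * ∫⁻ t in cubeRegion r, tiltedGauss g (θ ^ 2)⁻¹ (stdLatticeMap lam V t))
      ≤ ∫⁻ x in {x | θ • x ∈ invD lam '' boxRegion V r},
        ENNReal.ofReal (Real.exp (g (θ ^ 2 * ‖x‖ ^ 2))) ∂(limitNormal lam (latticeSpan V)) := by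
  have hscale : ∀ t, tiltedGauss g (θ ^ 2)⁻¹ (stdLatticeMap lam V (θ • t))
      = tiltedGauss 0 1 (stdLatticeMap lam V t)
        * ENNReal.ofReal (Real.exp (g (θ ^ 2 * ‖stdLatticeMap lam V t‖ ^ 2))) := fun t => by
    rw [tiltedGauss, tiltedGauss, map_smul, norm_smul, Real.norm_eq_abs, mul_pow, sq_abs,
      inv_mul_cancel_left₀ (by positivity), ← ENNReal.ofReal_mul (Real.exp_pos _).le,
      ← Real.exp_add, Pi.zero_apply, one_mul, zero_sub, sub_eq_neg_add]
  have hcomp := setLIntegral_comp_smul volume hθ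
    (fun t => tiltedGauss g (θ ^ 2)⁻¹ (stdLatticeMap lam V t)) (cubeRegion r)
  rw [Module.finrank_fin_fun] at hcomp
  refine le_trans ?_ (lintegral_indicator_le _ _)
  rw [limitNormal, ← range_stdLatticeMap, lintegral_subspaceGaussian_range volume hΦ,
    ← hcomp]
  refine mul_le_mul_right ?_ _
  rw [← lintegral_indicator ((measurableSet_cubeRegion r).preimage (measurable_const_smul θ))]
  refine lintegral_mono (Set.indicator_le fun t ht => ?_)
  have hmem : stdLatticeMap lam V t ∈ {x | θ • x ∈ invD lam '' boxRegion V r} := by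
    rw [Set.mem_ofPred_eq, ← map_smul, invD_image_boxRegion]
    exact Set.mem_image_of_mem _ ht
  rw [Set.indicator_of_mem hmem, hscale]

variable (lam V) in
/-- The expected number of count vectors per box, up to the Gaussian weight: the common number of
integer vectors in the boxes times the factor `gaussNorm lam` of the local limit theorem. -/
noncomputable def boxMass : ℝ≥0∞ :=
  (boxIntegers (meanVec lam) V 0).encard * ENNReal.ofReal (gaussNorm lam)

theorem boxMass_ne_zero (hlam : ∀ i, 0 < lam i)
    (h : ∃ m : Fin q → ℤ, intVec m - meanVec lam ∈ latticeSpan V) : boxMass lam V ≠ 0 := by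
  have hbox := (nonempty_boxIntegers_zero (meanVec lam) V h).encard_pos
  have hgauss := gaussNorm_pos hlam
  simp [boxMass, hbox.ne', hgauss]

theorem tsum_boxCounts_const {r : ℝ} (h : ∀ x ∈ boxRegion V r, ∀ i, -(lam i : ℝ) ≤ x i)
    {t : Fin s → ℝ} (ht : t ∈ cubeRegion r) {c : ℝ} (hc : 0 ≤ c) (b : ℝ≥0∞) :
    ∑' _ : boxCounts lam V (floorVec t), ENNReal.ofReal (gaussNorm lam * c) * b
      = boxMass lam V * ENNReal.ofReal c * b := by
  rw [ENNReal.tsum_set_const, ENNReal.ofReal_mul' hc, boxMass,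
    encard_boxCounts fun x hx => h x (latticeBox_subset_boxRegion V ht hx)]
  ring

namespace IsBoxLocalLimit

variable {g : ℝ → ℝ} {r ε : ℝ}

theorem setLIntegral_poissonLaw_le (h : IsBoxLocalLimit lam V g r ε)
    (hV : LinearIndependent ℝ fun a => intVec (V a)) (hmass : boxMass lam V ≠ ⊤) :
    ∫⁻ y in {y | countVec y - meanVec lam ∈ boxRegion V r},
        ENNReal.ofReal (Real.exp (g (‖stdVec lam y‖ ^ 2))) ∂(poissonLaw lam)
      ≤ boxMass lam V * ENNReal.ofReal (Real.exp ε)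
        * ∫⁻ t in cubeRegion r, tiltedGauss g (1 - ε) (stdLatticeMap lam V t) := by
  rw [setLIntegral_boxRegion_poissonLaw lam hV,
    ← lintegral_const_mul' _ _ (ENNReal.mul_ne_top hmass ENNReal.ofReal_ne_top)]
  refine setLIntegral_mono' (measurableSet_cubeRegion r) fun t ht => ?_
  rw [← tsum_boxCounts_const h.neg_mean_le ht (Real.exp_pos ε).le]
  exact ENNReal.tsum_le_tsum fun y => h.upper t ht y y.2

theorem le_poissonLaw_linearEvent (h : IsBoxLocalLimit lam V g r ε)
    (hV : LinearIndependent ℝ fun a => intVec (V a)) :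
    boxMass lam V * ENNReal.ofReal (Real.exp (-ε))
        * ∫⁻ t in cubeRegion r, tiltedGauss 0 (1 + ε) (stdLatticeMap lam V t)
      ≤ poissonLaw lam (linearEvent lam (latticeSpan V)) := by
  have hsub : {y | countVec y - meanVec lam ∈ boxRegion V r} ⊆ linearEvent lam (latticeSpan V) :=
    fun y hy => boxRegion_subset_latticeSpan V r hy
  refine le_trans ?_ (measure_mono hsub)
  rw [← setLIntegral_one, setLIntegral_boxRegion_poissonLaw lam hV]
  refine (lintegral_const_mul_le _ _).trans
    (setLIntegral_mono' (measurableSet_cubeRegion r) fun t ht => ?_)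
  rw [← tsum_boxCounts_const h.neg_mean_le ht (Real.exp_pos _).le]
  exact ENNReal.tsum_le_tsum fun y => (h.lower t ht y y.2).trans_eq (one_mul _).symm

theorem boxMass_mul_gaussMass_le (h : IsBoxLocalLimit lam V g r ε)
    (hV : LinearIndependent ℝ fun a => intVec (V a)) {a : ℝ}
    (hZ : gaussMass volume (stdLatticeMap lam V) ≤ ENNReal.ofReal a
      * ∫⁻ t in cubeRegion r, tiltedGauss 0 (1 + ε) (stdLatticeMap lam V t)) :
    boxMass lam V * gaussMass volume (stdLatticeMap lam V)
      ≤ ENNReal.ofReal (Real.exp ε) * ENNReal.ofReal a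
        * poissonLaw lam (linearEvent lam (latticeSpan V)) := by
  have hexp : ENNReal.ofReal (Real.exp ε) * ENNReal.ofReal (Real.exp (-ε)) = 1 := by
    rw [← ENNReal.ofReal_mul (Real.exp_pos ε).le, ← Real.exp_add]
    simp
  set I := ∫⁻ t in cubeRegion r, tiltedGauss 0 (1 + ε) (stdLatticeMap lam V t)
  calc boxMass lam V * gaussMass volume (stdLatticeMap lam V)
      ≤ boxMass lam V * (ENNReal.ofReal a * I) := by gcongr
    _ = ENNReal.ofReal (Real.exp ε) * ENNReal.ofReal (Real.exp (-ε))
          * (boxMass lam V * (ENNReal.ofReal a * I)) := by rw [hexp, one_mul]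
    _ = ENNReal.ofReal (Real.exp ε) * ENNReal.ofReal a
          * (boxMass lam V * ENNReal.ofReal (Real.exp (-ε)) * I) := by ring
    _ ≤ _ := by gcongr; exact h.le_poissonLaw_linearEvent hV

theorem setLIntegral_condLaw_le (h : IsBoxLocalLimit lam V g r ε)
    (hV : LinearIndependent ℝ fun a => intVec (V a)) (hlam : ∀ i, 0 < lam i) {a : ℝ}
    (hZ : gaussMass volume (stdLatticeMap lam V) ≤ ENNReal.ofReal a
      * ∫⁻ t in cubeRegion r, tiltedGauss 0 (1 + ε) (stdLatticeMap lam V t)) :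
    ∫⁻ y in {y | stdVec lam y ∈ invD lam '' boxRegion V r},
        ENNReal.ofReal (Real.exp (g (‖stdVec lam y‖ ^ 2))) ∂(condLaw lam (latticeSpan V))
      ≤ ENNReal.ofReal (Real.exp ε) ^ 2 * ENNReal.ofReal a
        * ((gaussMass volume (stdLatticeMap lam V))⁻¹
          * ∫⁻ t in cubeRegion r, tiltedGauss g (1 - ε) (stdLatticeMap lam V t)) := by
  have hΦ := stdLatticeMap_injective hV hlam
  have hZ0 := gaussMass_ne_zero volume hΦ
  have hPtop := measure_ne_top (poissonLaw lam) (linearEvent lam (latticeSpan V))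
  have hle := h.boxMass_mul_gaussMass_le hV hZ
  have hmass : boxMass lam V ≠ ⊤ := fun htop => by
    rw [htop, ENNReal.top_mul hZ0, top_le_iff] at hle
    exact ENNReal.mul_ne_top (ENNReal.mul_ne_top ENNReal.ofReal_ne_top ENNReal.ofReal_ne_top)
      hPtop hle
  set Z := gaussMass volume (stdLatticeMap lam V)
  set P := poissonLaw lam (linearEvent lam (latticeSpan V))
  set A := ∫⁻ t in cubeRegion r, tiltedGauss g (1 - ε) (stdLatticeMap lam V t)
  have hdiv : boxMass lam V / P ≤ ENNReal.ofReal (Real.exp ε) * ENNReal.ofReal a / Z := by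
    refine ENNReal.div_le_of_le_mul ?_
    rw [← ENNReal.mul_div_right_comm]
    exact (ENNReal.le_div_iff_mul_le (.inl hZ0) (.inl (gaussMass_ne_top volume hΦ))).2 hle
  have hregion : {y | stdVec lam y ∈ invD lam '' boxRegion V r}
      = {y | countVec y - meanVec lam ∈ boxRegion V r} :=
    Set.ext fun y => (invD_injective hlam).mem_set_image
  calc _ ≤ P⁻¹ * (boxMass lam V * ENNReal.ofReal (Real.exp ε) * A) := by
        rw [hregion]
        refine (setLIntegral_condLaw_le_inv_mul lam _ _ _).trans ?_
        gcongr
        exact h.setLIntegral_poissonLaw_le hV hmass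
    _ = boxMass lam V / P * (ENNReal.ofReal (Real.exp ε) * A) := by
        rw [div_eq_mul_inv]; ring
    _ ≤ ENNReal.ofReal (Real.exp ε) * ENNReal.ofReal a / Z
          * (ENNReal.ofReal (Real.exp ε) * A) := by gcongr
    _ = _ := by rw [div_eq_mul_inv]; ring

theorem poissonLaw_linearEvent_pos (h : IsBoxLocalLimit lam V g r ε)
    (hV : LinearIndependent ℝ fun a => intVec (V a)) (hlam : ∀ i, 0 < lam i)
    (hint : ∃ m : Fin q → ℤ, intVec m - meanVec lam ∈ latticeSpan V) {a : ℝ}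
    (hZ : gaussMass volume (stdLatticeMap lam V) ≤ ENNReal.ofReal a
      * ∫⁻ t in cubeRegion r, tiltedGauss 0 (1 + ε) (stdLatticeMap lam V t)) :
    0 < poissonLaw lam (linearEvent lam (latticeSpan V)) := by
  have hne := mul_ne_zero (boxMass_ne_zero hlam hint)
    (gaussMass_ne_zero volume (stdLatticeMap_injective hV hlam))
  exact pos_iff_ne_zero.2 (right_ne_zero_of_mul
    ((pos_iff_ne_zero.2 hne).trans_le (h.boxMass_mul_gaussMass_le hV hZ)).ne')

end IsBoxLocalLimit

end Comparison

section LimitTheorem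

open Filter Topology

variable {q s : ℕ} {τ : ℝ} {V : Fin s → Fin q → ℤ} {g : ℝ → ℝ} {θ : ℝ}

theorem eventually_ball_subset_cubeRegion (hτ : 0 < τ)
    (hV : LinearIndependent ℝ fun a => intVec (V a)) {η : ℝ} (hη : 0 < η) (R : ℝ) :
    ∀ᶠ lam in largeMeans τ, {t | ‖stdLatticeMap lam V t‖ ≤ R} ⊆ cubeRegion (η * totalMean lam) := by
  obtain ⟨δ, hδ, hsub⟩ := exists_eventually_subset_cubeRegion hτ hV hη
  filter_upwards [hsub, eventually_le_mul_sqrt_totalMean hδ R] with lam hsub hR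
  exact fun t ht => hsub (le_trans ht hR)

theorem exists_eventually_ofReal_exp_sq_mul_sq_le (hθ : 1 < θ) :
    ∃ a > 1, ∀ᶠ ε in 𝓝[>] (0 : ℝ),
      ENNReal.ofReal (Real.exp ε) ^ 2 * ENNReal.ofReal a ^ 2 ≤ ENNReal.ofReal θ := by
  have hθ0 : 0 ≤ θ := by linarith
  have hsqrt : 1 < √θ := Real.lt_sqrt_of_sq_lt (by linarith)
  refine ⟨√√θ, Real.lt_sqrt_of_sq_lt (by linarith), ?_⟩
  filter_upwards [eventually_exp_mul_le 2 hsqrt] with ε hε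
  rw [← ENNReal.ofReal_pow (Real.exp_pos ε).le, ← ENNReal.ofReal_pow (Real.sqrt_nonneg _),
    Real.sq_sqrt (Real.sqrt_nonneg θ), ← ENNReal.ofReal_mul (by positivity)]
  refine ENNReal.ofReal_le_ofReal ?_
  calc Real.exp ε ^ 2 * √θ = Real.exp (ε * 2) * √θ := by rw [mul_two, Real.exp_add, sq]
    _ ≤ √θ * √θ := by gcongr
    _ = θ := Real.mul_self_sqrt hθ0

theorem exists_eventually_setLIntegral_condLaw_le (hτ : 0 < τ)
    (hV : LinearIndependent ℝ fun a => intVec (V a)) (hg_unif : UniformContinuousOn g (Set.Ici 0))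
    (hg_mono : MonotoneOn g (Set.Ici 0)) (hθ : 1 < θ) :
    ∃ η > 0, ∀ᶠ lam in largeMeans τ,
      (∃ m : Fin q → ℤ, intVec m - meanVec lam ∈ latticeSpan V) →
      0 < poissonLaw lam (linearEvent lam (latticeSpan V)) ∧
      ∫⁻ y in {y | stdVec lam y ∈ invD lam '' boxRegion V (η * totalMean lam)},
          ENNReal.ofReal (Real.exp (g (‖stdVec lam y‖ ^ 2))) ∂(condLaw lam (latticeSpan V))
        ≤ ENNReal.ofReal θ *
          ∫⁻ x in {x | θ • x ∈ invD lam '' boxRegion V (η * totalMean lam)},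
            ENNReal.ofReal (Real.exp (g (θ ^ 2 * ‖x‖ ^ 2)))
              ∂(limitNormal lam (latticeSpan V)) := by
  obtain ⟨a, ha, hexp⟩ := exists_eventually_ofReal_exp_sq_mul_sq_le hθ
  obtain ⟨R, hupper, hlower⟩ := ((eventually_setLIntegral_tiltedGauss_le
    (volume : Measure (Fin s → ℝ)) (G := EuclideanSpace ℝ (Fin q)) hθ ha).and
    (eventually_gaussMass_le_mul_setLIntegral_tiltedGauss
      (volume : Measure (Fin s → ℝ)) (G := EuclideanSpace ℝ (Fin q)) ha)).exists
  obtain ⟨ε, ⟨⟨hexp, hupper⟩, hlower⟩, hε : 0 < ε⟩ :=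
    (((hexp.and hupper).and hlower).and self_mem_nhdsWithin).exists
  obtain ⟨η, hη, hlimit⟩ := exists_eventually_isBoxLocalLimit hτ V hg_unif hε
  refine ⟨η, hη, ?_⟩
  filter_upwards [hlimit, eventually_mean_pos hτ, eventually_ball_subset_cubeRegion hτ hV hη R]
    with lam hlimit hlam hball hint
  have hΦ := stdLatticeMap_injective hV hlam
  have hZ := hlower _ _ (gaussMass_ne_top volume hΦ) hball
  refine ⟨hlimit.poissonLaw_linearEvent_pos hV hlam hint hZ, ?_⟩
  have hA := hupper g _ _ hg_mono (measurableSet_cubeRegion _) hball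
  rw [Module.finrank_fin_fun, ENNReal.ofReal_mul (by linarith)] at hA
  set Z := gaussMass volume (stdLatticeMap lam V)
  set B := ∫⁻ t in cubeRegion (η * totalMean lam),
    tiltedGauss g (θ ^ 2)⁻¹ (stdLatticeMap lam V t)
  calc _ ≤ ENNReal.ofReal (Real.exp ε) ^ 2 * ENNReal.ofReal a
          * (Z⁻¹ * (ENNReal.ofReal a * ENNReal.ofReal (θ ^ s)⁻¹ * B)) :=
        (hlimit.setLIntegral_condLaw_le hV hlam hZ).trans (by gcongr)
    _ = ENNReal.ofReal (Real.exp ε) ^ 2 * ENNReal.ofReal a ^ 2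
          * (Z⁻¹ * (ENNReal.ofReal (θ ^ s)⁻¹ * B)) := by ring
    _ ≤ _ := by gcongr; exact le_setLIntegral_limitNormal hΦ g (by linarith) _

end LimitTheorem

theorem mainTheorem2 {q s : ℕ} (τ : ℝ) (hτ : 0 < τ)
    (V : Fin s → Fin q → ℤ) (hV : LinearIndependent ℝ fun a => intVec (V a))
    (g : ℝ → ℝ) (hg_unif : UniformContinuousOn g (Set.Ici 0)) (hg_mono : MonotoneOn g (Set.Ici 0))
    (θ : ℝ) (hθ : 1 < θ) :
    ∃ δ : ℝ, 0 < δ ∧ ∃ η : ℝ, 0 < η ∧ ∃ ν₀ : ℝ, ∀ lam : Fin q → ℝ≥0,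
      ν₀ ≤ totalMean lam →
      (∀ i, τ * totalMean lam ≤ (lam i : ℝ)) →
      (∃ m : Fin q → ℤ, intVec m - meanVec lam ∈ latticeSpan V) →
      0 < poissonLaw lam (linearEvent lam (latticeSpan V)) ∧
      ∃ Lδ : Set (EuclideanSpace ℝ (Fin q)),
        Lδ = boxRegion V (η * totalMean lam) ∧
        Lδ ⊆ (latticeSpan V : Set (EuclideanSpace ℝ (Fin q))) ∧
        {x : EuclideanSpace ℝ (Fin q) | x ∈ (latticeSpan V).map (invD lam) ∧
          ‖x‖ ≤ δ * Real.sqrt (totalMean lam)} ⊆ invD lam '' Lδ ∧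
        ∫⁻ y in {y | stdVec lam y ∈ invD lam '' Lδ},
            ENNReal.ofReal (Real.exp (g (‖stdVec lam y‖ ^ 2))) ∂(condLaw lam (latticeSpan V))
          ≤ ENNReal.ofReal θ *
            ∫⁻ x in {x | θ • x ∈ invD lam '' Lδ},
              ENNReal.ofReal (Real.exp (g (θ ^ 2 * ‖x‖ ^ 2)))
                ∂(limitNormal lam (latticeSpan V)) := by
  obtain ⟨η, hη, hlimit⟩ := exists_eventually_setLIntegral_condLaw_le hτ hV hg_unif hg_mono hθ
  obtain ⟨δ, hδ, hball⟩ := exists_eventually_subset_cubeRegion hτ hV hη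
  obtain ⟨ν₀, hν₀⟩ := eventually_largeMeans_iff.1 (hlimit.and hball)
  refine ⟨δ, hδ, η, hη, ν₀, fun lam hν hlam hint => ?_⟩
  obtain ⟨hlimit, hball⟩ := hν₀ lam hν hlam
  exact ⟨(hlimit hint).1, _, rfl, boxRegion_subset_latticeSpan V _,
    map_latticeSpan_inter_subset_image_boxRegion hball, (hlimit hint).2⟩
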